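/- Consider a discrete memoryless broadcast interference channel with finite input alphabets $\mathcal X_1,\mathcal X_2$, finite output alphabets $\mathcal Y_1,\mathcal Y_2,\mathcal Y_3$ and transition probability $$p(y_1,y_2,y_3|x_1,x_2)=p(y_1|x_1)\,p(y_2|x_1,x_2)\,p(y_3|x_2).$$ An $(M_1,M_2,M_3,n)$ code consists of message sets $\mathcal W_j=\{1,\dots,M_j\}$ ($j=1,2,3$), encoders $\mathcal W_1\times\mathcal W_2\to\mathcal X_1^n$ and $\mathcal W_3\to\mathcal X_2^n$, and decoders $g_j:\mathcal Y_j^n\to\mathcal W_j$. With independent messages $W_j$ uniform on $\mathcal W_j$ and $n$ memoryless uses of the channel, its error probability is $P_e=\Pr\big(g_1(Y_1^n)\ne W_1\text{ or }g_2(Y_2^n)\ne W_2\text{ or }g_3(Y_3^n)\ne W_3\big)$ and its rates are $\frac1n\log_2 M_j$. A triple $(R_1,R_2,R_3)$ is achievable if there is a sequence of $(M_1,M_2,M_3,n)$ codes, $n\to\infty$, whose rates converge to $(R_1,R_2,R_3)$ and for which $P_e\to0$. Mutual informations are in bits. Write $Y_1\succ_c Y_2$ (receiver 1 is interference-cognizant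 less noisy than receiver 2) if $I(U_1;Y_1)\ge I(U_1;Y_2|X_2)$ for every finitely valued $U_1$ and every joint distribution $p(u_1,x_1)p(x_2)$ such that $U_1\to(X_1,X_2)\to(Y_1,Y_2)$ is a Markov chain. Let $\mathcal R_{(2)}$ be the closure of the set of all $(R_1,R_2,R_3)$ satisfying $$\begin{aligned} R_1&\le I(X_1;Y_1|U_1),\\ R_2&\le I(U_1;Y_2|U_2),\\ R_3&\le I(X_2;Y_3),\\ R_2+R_3&\le I(U_1,U_2;Y_2)+I(X_2;Y_3|U_2),\\ R_1,R_2,R_3&\ge 0 \end{aligned}$$ for some finitely valued $U_1,U_2$ and some joint distribution $p(u_1)p(x_1|u_1)p(u_2)p(x_2|u_2)$, where $(U_1,U_2)\to(X_1,X_2)\to(Y_1,Y_2,Y_3)$ is a Markov chain. **Theorem.** If $Y_1\succ_c Y_2$, then $\mathcal R_{(2)}$ is an achievable rate region: every $(R_1,R_2,R_3)\in\mathcal R_{(2)}$ is achievable. -/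

import Mathlib

noncomputable section

namespace BIC

/-! ### Information measures of finite random variables

`μ : Ω → ℝ` is a probability mass function on a finite set `Ω`, and random variables are
functions on `Ω`. Logarithms are to base 2. -/

section Information

variable {Ω α β γ : Type*} [Fintype Ω] [Fintype α] [Fintype β] [Fintype γ]

open Classical in
/-- The probability `p(a) = Pr(X = a)`. -/
def prob (μ : Ω → ℝ) (X : Ω → α) (a : α) : ℝ :=
  ∑ ω : Ω, if X ω = a then μ ω else 0

/-- Mutual information `I(X;Y) = ∑ p(x,y) log₂ (p(x,y) / (p(x) p(y)))` in bits; a term with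
`p(x,y) = 0` is zero. -/
def mutualInfo (μ : Ω → ℝ) (X : Ω → α) (Y : Ω → β) : ℝ :=
  ∑ x : α, ∑ y : β,
    prob μ (fun ω => (X ω, Y ω)) (x, y) *
      Real.logb 2 (prob μ (fun ω => (X ω, Y ω)) (x, y) / (prob μ X x * prob μ Y y))

/-- Conditional mutual information
`I(X;Y|Z) = ∑ p(x,y,z) log₂ (p(x,y|z) / (p(x|z) p(y|z)))` in bits, where the ratio is written
as `p(x,y,z) p(z) / (p(x,z) p(y,z))`; a term with `p(x,y,z) = 0` is zero. -/
def condMutualInfo (μ : Ω → ℝ) (X : Ω → α) (Y : Ω → β) (Z : Ω → γ) : ℝ :=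
  ∑ x : α, ∑ y : β, ∑ z : γ,
    prob μ (fun ω => (X ω, Y ω, Z ω)) (x, y, z) *
      Real.logb 2
        (prob μ (fun ω => (X ω, Y ω, Z ω)) (x, y, z) * prob μ Z z /
          (prob μ (fun ω => (X ω, Z ω)) (x, z) * prob μ (fun ω => (Y ω, Z ω)) (y, z)))

end Information

/-- A discrete memoryless broadcast interference channel, with transition probability
`p(y₁,y₂,y₃|x₁,x₂) = p(y₁|x₁) p(y₂|x₁,x₂) p(y₃|x₂)`. -/
structure Channel (X₁ X₂ Y₁ Y₂ Y₃ : Type*) [Fintype Y₁] [Fintype Y₂] [Fintype Y₃] where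
  /-- `p(y₁|x₁)` -/
  p₁ : X₁ → Y₁ → ℝ
  /-- `p(y₂|x₁,x₂)` -/
  p₂ : X₁ → X₂ → Y₂ → ℝ
  /-- `p(y₃|x₂)` -/
  p₃ : X₂ → Y₃ → ℝ
  p₁_mem : ∀ x₁, p₁ x₁ ∈ stdSimplex ℝ Y₁
  p₂_mem : ∀ x₁ x₂, p₂ x₁ x₂ ∈ stdSimplex ℝ Y₂
  p₃_mem : ∀ x₂, p₃ x₂ ∈ stdSimplex ℝ Y₃

/-- An `(M₁,M₂,M₃,n)` code. -/
structure Code (X₁ X₂ Y₁ Y₂ Y₃ : Type*) (M₁ M₂ M₃ n : ℕ) where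
  enc₁ : Fin M₁ → Fin M₂ → (Fin n → X₁)
  enc₂ : Fin M₃ → (Fin n → X₂)
  dec₁ : (Fin n → Y₁) → Fin M₁
  dec₂ : (Fin n → Y₂) → Fin M₂
  dec₃ : (Fin n → Y₃) → Fin M₃

section Channel

variable {X₁ X₂ Y₁ Y₂ Y₃ : Type*}
  [Fintype X₁] [Fintype X₂] [Fintype Y₁] [Fintype Y₂] [Fintype Y₃]

/-- The transition probability `p(y₁,y₂,y₃|x₁,x₂)`. -/
def Channel.trans (W : Channel X₁ X₂ Y₁ Y₂ Y₃) (x₁ : X₁) (x₂ : X₂) (y : Y₁ × Y₂ × Y₃) : ℝ :=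
  W.p₁ x₁ y.1 * W.p₂ x₁ x₂ y.2.1 * W.p₃ x₂ y.2.2

open Classical in
/-- The average error probability
`Pr(g₁(Y₁ⁿ) ≠ W₁ or g₂(Y₂ⁿ) ≠ W₂ or g₃(Y₃ⁿ) ≠ W₃)` of a code, for independent messages `Wⱼ`
uniform on `Mⱼ` values and `n` memoryless uses of the channel. -/
def Channel.errorProb (W : Channel X₁ X₂ Y₁ Y₂ Y₃) {M₁ M₂ M₃ n : ℕ}
    (c : Code X₁ X₂ Y₁ Y₂ Y₃ M₁ M₂ M₃ n) : ℝ :=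
  (∑ w₁ : Fin M₁, ∑ w₂ : Fin M₂, ∑ w₃ : Fin M₃,
    ∑ y₁ : Fin n → Y₁, ∑ y₂ : Fin n → Y₂, ∑ y₃ : Fin n → Y₃,
      if c.dec₁ y₁ ≠ w₁ ∨ c.dec₂ y₂ ≠ w₂ ∨ c.dec₃ y₃ ≠ w₃ then
        ∏ i : Fin n, W.trans (c.enc₁ w₁ w₂ i) (c.enc₂ w₃ i) (y₁ i, y₂ i, y₃ i)
      else 0) / ((M₁ : ℝ) * M₂ * M₃)

/-- `(R₁,R₂,R₃)` is achievable: there is a sequence of `(M₁,M₂,M₃,n)` codes, one for each block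
length `n`, whose rates `log₂(Mⱼ)/n` converge to `Rⱼ` and whose average error probability
converges to `0`. -/
def Channel.Achievable (W : Channel X₁ X₂ Y₁ Y₂ Y₃) (R : ℝ × ℝ × ℝ) : Prop :=
  ∃ (M₁ M₂ M₃ : ℕ → ℕ) (c : ∀ n, Code X₁ X₂ Y₁ Y₂ Y₃ (M₁ n) (M₂ n) (M₃ n) n),
    (∀ n, 1 ≤ M₁ n ∧ 1 ≤ M₂ n ∧ 1 ≤ M₃ n) ∧
    Filter.Tendsto (fun n : ℕ => Real.logb 2 (M₁ n) / n) Filter.atTop (nhds R.1) ∧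
    Filter.Tendsto (fun n : ℕ => Real.logb 2 (M₂ n) / n) Filter.atTop (nhds R.2.1) ∧
    Filter.Tendsto (fun n : ℕ => Real.logb 2 (M₃ n) / n) Filter.atTop (nhds R.2.2) ∧
    Filter.Tendsto (fun n : ℕ => W.errorProb (c n)) Filter.atTop (nhds 0)

/-- The joint law of `(A, Y₁, Y₂, Y₃)` when `A` has law `p`, the channel inputs are the functions
`f₁ A`, `f₂ A` of `A`, and `A → (X₁,X₂) → (Y₁,Y₂,Y₃)` is a Markov chain. -/
def Channel.joint (W : Channel X₁ X₂ Y₁ Y₂ Y₃) {A : Type*} (p : A → ℝ) (f₁ : A → X₁) (f₂ : A → X₂) :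
    A × Y₁ × Y₂ × Y₃ → ℝ :=
  fun ω => p ω.1 * W.trans (f₁ ω.1) (f₂ ω.1) ω.2

/-- Receiver 1 is interference-cognizant less noisy than receiver 2:
`I(U₁;Y₁) ≥ I(U₁;Y₂|X₂)` for all `p(u₁,x₁) p(x₂)` such that
`U₁ → (X₁,X₂) → (Y₁,Y₂)`. -/
def Channel.CognizantLessNoisy (W : Channel X₁ X₂ Y₁ Y₂ Y₃) : Prop :=
  ∀ (k : ℕ) (p : Fin k × X₁ → ℝ) (q : X₂ → ℝ),
    p ∈ stdSimplex ℝ (Fin k × X₁) → q ∈ stdSimplex ℝ X₂ →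
    let μ : (Fin k × X₁ × X₂) × Y₁ × Y₂ × Y₃ → ℝ :=
      W.joint (fun a => p (a.1, a.2.1) * q a.2.2) (fun a => a.2.1) (fun a => a.2.2)
    condMutualInfo μ (fun ω => ω.1.1) (fun ω => ω.2.2.1) (fun ω => ω.1.2.2) ≤
      mutualInfo μ (fun ω => ω.1.1) (fun ω => ω.2.1)

/-- The rate triples that satisfy the bounds of the superposition region for the input
distribution `p(u₁) p(x₁|u₁) p(u₂) p(x₂|u₂)`. -/
def Channel.superpositionBounds (W : Channel X₁ X₂ Y₁ Y₂ Y₃) {k₁ k₂ : ℕ}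
    (pU₁ : Fin k₁ → ℝ) (pX₁ : Fin k₁ → X₁ → ℝ) (pU₂ : Fin k₂ → ℝ) (pX₂ : Fin k₂ → X₂ → ℝ) :
    Set (ℝ × ℝ × ℝ) :=
  let Ω := (Fin k₁ × X₁ × Fin k₂ × X₂) × Y₁ × Y₂ × Y₃
  let U₁ : Ω → Fin k₁ := fun ω => ω.1.1
  let X₁' : Ω → X₁ := fun ω => ω.1.2.1
  let U₂ : Ω → Fin k₂ := fun ω => ω.1.2.2.1
  let X₂' : Ω → X₂ := fun ω => ω.1.2.2.2
  let Y₁' : Ω → Y₁ := fun ω => ω.2.1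
  let Y₂' : Ω → Y₂ := fun ω => ω.2.2.1
  let Y₃' : Ω → Y₃ := fun ω => ω.2.2.2
  let μ : Ω → ℝ :=
    W.joint (fun a => pU₁ a.1 * pX₁ a.1 a.2.1 * pU₂ a.2.2.1 * pX₂ a.2.2.1 a.2.2.2)
      (fun a => a.2.1) (fun a => a.2.2.2)
  {R | 0 ≤ R.1 ∧ 0 ≤ R.2.1 ∧ 0 ≤ R.2.2 ∧
    R.1 ≤ condMutualInfo μ X₁' Y₁' U₁ ∧
    R.2.1 ≤ condMutualInfo μ U₁ Y₂' U₂ ∧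
    R.2.2 ≤ mutualInfo μ X₂' Y₃' ∧
    R.2.1 + R.2.2 ≤
      mutualInfo μ (fun ω => (U₁ ω, U₂ ω)) Y₂' + condMutualInfo μ X₂' Y₃' U₂}

/-- The superposition region: the closure of the set of all triples that satisfy the bounds for
some input distribution `p(u₁) p(x₁|u₁) p(u₂) p(x₂|u₂)` with finitely valued `U₁`, `U₂`. -/
def Channel.superpositionRegion (W : Channel X₁ X₂ Y₁ Y₂ Y₃) : Set (ℝ × ℝ × ℝ) :=
  closure {R | ∃ (k₁ k₂ : ℕ)
    (pU₁ : Fin k₁ → ℝ) (pX₁ : Fin k₁ → X₁ → ℝ) (pU₂ : Fin k₂ → ℝ) (pX₂ : Fin k₂ → X₂ → ℝ),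
    pU₁ ∈ stdSimplex ℝ (Fin k₁) ∧ (∀ u, pX₁ u ∈ stdSimplex ℝ X₁) ∧
    pU₂ ∈ stdSimplex ℝ (Fin k₂) ∧ (∀ u, pX₂ u ∈ stdSimplex ℝ X₂) ∧
    R ∈ W.superpositionBounds pU₁ pX₁ pU₂ pX₂}

end Channel

end BIC

end

/-! Both senders use random superposition codebooks. Sender 1 puts W₂ on the cloud centers u₁ⁿ and
W₁ on the satellites x₁ⁿ. Sender 2 splits W₃ into a cloud index of rate s and a satellite index of
rate t, with s + t = R₃. Receiver 1 decodes cloud and satellite of sender 1, and receiver 3 those of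
sender 2. Receiver 2 decodes u₁ⁿ with the help of u₂ⁿ, without having to identify u₂ⁿ. This works
when R₁ ≤ I(X₁;Y₁|U₁), R₁ + R₂ ≤ I(X₁;Y₁), R₂ ≤ I(U₁;Y₂|U₂), s + R₂ ≤ I(U₁,U₂;Y₂), t ≤ I(X₂;Y₃|U₂)
and s + t ≤ I(X₂;Y₃) (`approximable_of_split`).

The region has no bound on R₁ + R₂; the less noisy condition supplies it. Indeed R₂ ≤ I(U₁;Y₂|U₂) ≤
I(U₁;Y₂|X₂) ≤ I(U₁;Y₁) (`CognizantLessNoisy.infoC_le`), and the chain rule `infoT_eq` adds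
I(X₁;Y₁|U₁). The choice t = min(R₃, I(X₂;Y₃|U₂)) turns the remaining bounds into those of the
region.

Decoding uses likelihood-ratio thresholds instead of typical sets. A wrong codeword passes with
probability at most 1/threshold, by a change of measure, which gives the one-shot bound
`exists_one_shot_code`. For product laws the true codeword passes with probability 1 - O(1/n), by
Chebyshev's inequality (`exists_missProb_le`). -/

noncomputable section

namespace BIC

/-! ### Finite expectations and indicators. -/

section Expectation

variable {Ω A B : Type*} [Fintype Ω] [Fintype A] [Fintype B]

/-- The expectation of `f` under the mass function `μ`. -/
def ev (μ f : Ω → ℝ) : ℝ := ∑ ω, μ ω * f ω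

open Classical in
/-- The indicator of a proposition. -/
def ind (p : Prop) : ℝ := if p then 1 else 0

lemma ind_nonneg (p : Prop) : 0 ≤ ind p := by unfold ind; split_ifs <;> norm_num

lemma ind_of {p : Prop} (h : p) : ind p = 1 := if_pos h

lemma ind_of_not {p : Prop} (h : ¬p) : ind p = 0 := if_neg h

lemma ind_mono {p q : Prop} (h : p → q) : ind p ≤ ind q := by
  by_cases hp : p
  · rw [ind_of hp, ind_of (h hp)]
  · rw [ind_of_not hp]; exact ind_nonneg q

lemma ind_or_le (p q : Prop) : ind (p ∨ q) ≤ ind p + ind q := by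
  by_cases hp : p
  · rw [ind_of (Or.inl hp), ind_of hp]; linarith [ind_nonneg q]
  · rw [ind_of_not hp, zero_add]; exact ind_mono (by tauto)

lemma ind_exists_le {ι : Type*} (s : Finset ι) (p : ι → Prop) :
    ind (∃ i ∈ s, p i) ≤ ∑ i ∈ s, ind (p i) := by
  by_cases h : ∃ i ∈ s, p i
  · obtain ⟨i, hi, hp⟩ := h
    rw [ind_of ⟨i, hi, hp⟩, ← ind_of hp]
    exact Finset.single_le_sum (f := fun i => ind (p i)) (fun _ _ => ind_nonneg _) hi
  · rw [ind_of_not h]; exact Finset.sum_nonneg fun _ _ => ind_nonneg _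

lemma ev_mono {μ f g : Ω → ℝ} (hμ : ∀ ω, 0 ≤ μ ω) (h : ∀ ω, f ω ≤ g ω) : ev μ f ≤ ev μ g :=
  Finset.sum_le_sum fun ω _ => mul_le_mul_of_nonneg_left (h ω) (hμ ω)

lemma ev_nonneg {μ f : Ω → ℝ} (hμ : ∀ ω, 0 ≤ μ ω) (h : ∀ ω, 0 ≤ f ω) : 0 ≤ ev μ f :=
  Finset.sum_nonneg fun ω _ => mul_nonneg (hμ ω) (h ω)

lemma ev_add (μ f g : Ω → ℝ) : ev μ (fun ω => f ω + g ω) = ev μ f + ev μ g := by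
  simp [ev, mul_add, Finset.sum_add_distrib]

lemma ev_sub (μ f g : Ω → ℝ) : ev μ (fun ω => f ω - g ω) = ev μ f - ev μ g := by
  simp [ev, mul_sub, Finset.sum_sub_distrib]

lemma ev_const_mul (μ f : Ω → ℝ) (a : ℝ) : ev μ (fun ω => a * f ω) = a * ev μ f := by
  simp [ev, Finset.mul_sum, mul_left_comm]

lemma ev_mul_const (μ f : Ω → ℝ) (a : ℝ) : ev μ (fun ω => f ω * a) = ev μ f * a := by
  simp [ev, Finset.sum_mul, mul_assoc]

lemma ev_sum {ι : Type*} (s : Finset ι) (μ : Ω → ℝ) (f : ι → Ω → ℝ) :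
    ev μ (fun ω => ∑ i ∈ s, f i ω) = ∑ i ∈ s, ev μ (f i) := by
  simp only [ev, Finset.mul_sum]; exact Finset.sum_comm

lemma ev_const {μ : Ω → ℝ} (hμ : μ ∈ stdSimplex ℝ Ω) (a : ℝ) : ev μ (fun _ => a) = a := by
  simp [ev, ← Finset.sum_mul, hμ.2]

lemma ev_comm (p : A → ℝ) (q : B → ℝ) (f : A → B → ℝ) :
    ev p (fun a => ev q (f a)) = ev q (fun b => ev p fun a => f a b) := by
  simp only [ev, Finset.mul_sum]
  rw [Finset.sum_comm]
  exact Finset.sum_congr rfl fun _ _ => Finset.sum_congr rfl fun _ _ => by ring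

lemma ev_prod (p : A → ℝ) (κ : A → B → ℝ) (f : A × B → ℝ) :
    ev (fun ω : A × B => p ω.1 * κ ω.1 ω.2) f = ev p fun a => ev (κ a) fun b => f (a, b) := by
  simp only [ev, Finset.mul_sum, Fintype.sum_prod_type, mul_assoc]

lemma mem_stdSimplex_prod {p : A → ℝ} {κ : A → B → ℝ} (hp : p ∈ stdSimplex ℝ A)
    (hκ : ∀ a, κ a ∈ stdSimplex ℝ B) :
    (fun ω : A × B => p ω.1 * κ ω.1 ω.2) ∈ stdSimplex ℝ (A × B) := by
  refine ⟨fun ω => mul_nonneg (hp.1 _) ((hκ _).1 _), ?_⟩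
  have := ev_prod p κ fun _ => 1
  simp only [ev_const (hκ _), ev_const hp] at this
  simpa [ev] using this

lemma ev_mem_stdSimplex {p : A → ℝ} {κ : A → B → ℝ} (hp : p ∈ stdSimplex ℝ A)
    (hκ : ∀ a, κ a ∈ stdSimplex ℝ B) :
    (fun b => ev p fun a => κ a b) ∈ stdSimplex ℝ B := by
  refine ⟨fun b => ev_nonneg hp.1 fun a => (hκ a).1 b, ?_⟩
  rw [← ev_sum]
  simp only [(hκ _).2, ev_const hp]

/-- Expectations under a mixture. -/
lemma ev_ev (p : A → ℝ) (κ : A → B → ℝ) (f : B → ℝ) :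
    ev (fun b => ev p fun a => κ a b) f = ev p fun a => ev (κ a) f := by
  simp only [ev, Finset.sum_mul, Finset.mul_sum]
  rw [Finset.sum_comm]
  exact Finset.sum_congr rfl fun _ _ => Finset.sum_congr rfl fun _ _ => by ring

end Expectation

/-! ### Independent, identically distributed families. -/

section Iid

variable {ι A B : Type*} [Fintype ι] [Fintype A] [Fintype B] [DecidableEq ι]

/-- The law of independent variables with common law `q`. -/
def iid (q : A → ℝ) : (ι → A) → ℝ := fun c => ∏ i, q (c i)

lemma sum_pi_prod (f : ι → A → ℝ) : ∑ c : ι → A, ∏ i, f i (c i) = ∏ i, ∑ a, f i a := by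
  rw [Finset.prod_univ_sum, Fintype.piFinset_univ]

lemma iid_mem {q : A → ℝ} (hq : q ∈ stdSimplex ℝ A) :
    (iid q : (ι → A) → ℝ) ∈ stdSimplex ℝ (ι → A) := by
  refine ⟨fun c => Finset.prod_nonneg fun i _ => hq.1 _, ?_⟩
  simp only [iid]
  rw [sum_pi_prod fun _ => q]
  simp [hq.2]

lemma ev_iid_prod (q : A → ℝ) (f : ι → A → ℝ) :
    ev (iid q) (fun c => ∏ i, f i (c i)) = ∏ i, ev q (f i) := by
  simp only [ev, iid, ← Finset.prod_mul_distrib]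
  exact sum_pi_prod fun i a => q a * f i a

lemma ev_iid_mul {q : A → ℝ} (hq : q ∈ stdSimplex ℝ A) {i j : ι} (hij : i ≠ j) (f g : A → ℝ) :
    ev (iid q) (fun c : ι → A => f (c i) * g (c j)) = ev q f * ev q g := by
  have h := ev_iid_prod q fun (k : ι) a => if k = i then f a else if k = j then g a else 1
  have h1 : ∀ F : ι → ℝ, (∀ k, k ≠ i → k ≠ j → F k = 1) → ∏ k, F k = F i * F j := by
    intro F hF
    rw [Finset.prod_eq_mul i j hij (fun k _ hk => hF k hk.1 hk.2) (by simp) (by simp)]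
  rw [h1 (fun k => ev q fun a => if k = i then f a else if k = j then g a else 1)] at h
  · simp only [if_true, hij.symm, if_false] at h
    rw [← h]
    congr 1; funext c
    rw [h1]
    · simp [hij.symm]
    · intro k h1 h2; simp [h1, h2]
  · intro k h1 h2; simp [h1, h2, ev_const hq]

lemma ev_iid_apply {q : A → ℝ} (hq : q ∈ stdSimplex ℝ A) (i : ι) (f : A → ℝ) :
    ev (iid q) (fun c : ι → A => f (c i)) = ev q f := by
  have h := ev_iid_prod q fun (k : ι) a => if k = i then f a else 1
  have h1 : ∀ F : ι → ℝ, (∀ k, k ≠ i → F k = 1) → ∏ k, F k = F i := fun F hF =>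
    Finset.prod_eq_single i (fun k _ hk => hF k hk) (by simp)
  rw [h1 (fun k => ev q _)] at h
  · simp only [if_true] at h
    rw [← h]
    congr 1; funext c
    rw [h1]
    · simp
    · intro k h1; simp [h1]
  · intro k h1; simp [h1, ev_const hq]

/-- A function of two letters is a linear combination of products of point indicators, so
independence for products (`ev_iid_mul`) suffices. -/
lemma ev_iid_apply₂ {q : A → ℝ} (hq : q ∈ stdSimplex ℝ A) {i j : ι} (hij : i ≠ j)
    (f : A → A → ℝ) :
    ev (iid q) (fun c : ι → A => f (c i) (c j)) = ev q fun a => ev q fun b => f a b := by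
  classical
  have hf : ∀ x y : A, f x y = ∑ a, ∑ b, f a b * (ind (x = a) * ind (y = b)) := by
    intro x y
    simp [ind]
  calc _ = ∑ a, ∑ b, f a b * (ev q (fun x => ind (x = a)) * ev q (fun y => ind (y = b))) := by
        conv_lhs => enter [2, c]; rw [hf]
        simp only [ev_sum, ev_const_mul]
        refine Finset.sum_congr rfl fun a _ => Finset.sum_congr rfl fun b _ => ?_
        rw [← ev_iid_mul hq hij (fun x => ind (x = a))]
    _ = _ := by
        simp [ev, ind, Finset.mul_sum]
        exact Finset.sum_congr rfl fun _ _ => Finset.sum_congr rfl fun _ _ => by ring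

end Iid

/-! ### Random superposition codebooks. -/

section Book

variable {I K U X : Type*} [Fintype I] [Fintype K] [Fintype U] [Fintype X]
  [DecidableEq I] [DecidableEq K] {P : U → ℝ} {S : U → X → ℝ}

/-- The law of a superposition codebook: cloud centers `u(i)` with law `P` and, around each of
them, satellite codewords `x(i,k)` with law `S u(i)`. -/
def bookLaw (P : U → ℝ) (S : U → X → ℝ) : (I → U × (K → X)) → ℝ :=
  iid fun a => P a.1 * iid (S a.1) a.2

lemma cluster_mem (hP : P ∈ stdSimplex ℝ U) (hS : ∀ u, S u ∈ stdSimplex ℝ X) :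
    (fun a : U × (K → X) => P a.1 * iid (S a.1) a.2) ∈ stdSimplex ℝ (U × (K → X)) :=
  mem_stdSimplex_prod (κ := fun u => iid (S u)) hP fun u => iid_mem (hS u)

lemma bookLaw_mem (hP : P ∈ stdSimplex ℝ U) (hS : ∀ u, S u ∈ stdSimplex ℝ X) :
    (bookLaw P S : (I → U × (K → X)) → ℝ) ∈ stdSimplex ℝ (I → U × (K → X)) :=
  iid_mem (cluster_mem hP hS)

lemma ev_cluster (f : U → (K → X) → ℝ) :
    ev (fun a : U × (K → X) => P a.1 * iid (S a.1) a.2) (fun a => f a.1 a.2) =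
      ev P fun u => ev (iid (S u)) (f u) :=
  ev_prod P (fun u => iid (S u)) _

lemma ev_book (hP : P ∈ stdSimplex ℝ U) (hS : ∀ u, S u ∈ stdSimplex ℝ X) (i : I) (k : K)
    (f : U → X → ℝ) :
    ev (bookLaw P S) (fun c : I → U × (K → X) => f (c i).1 ((c i).2 k)) =
      ev P fun u => ev (S u) (f u) := by
  rw [bookLaw, ev_iid_apply (cluster_mem hP hS) i fun a => f a.1 (a.2 k),
    ev_cluster fun u xs => f u (xs k)]
  simp only [ev_iid_apply (hS _)]

/-- Two satellites of one cloud are independent only conditionally on their common center. -/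
lemma ev_book_satellite (hP : P ∈ stdSimplex ℝ U) (hS : ∀ u, S u ∈ stdSimplex ℝ X) (i : I)
    {k k' : K} (hk : k ≠ k') (f : U → X → X → ℝ) :
    ev (bookLaw P S) (fun c : I → U × (K → X) => f (c i).1 ((c i).2 k) ((c i).2 k')) =
      ev P fun u => ev (S u) fun x => ev (S u) fun x' => f u x x' := by
  rw [bookLaw, ev_iid_apply (cluster_mem hP hS) i fun a => f a.1 (a.2 k) (a.2 k'),
    ev_cluster fun u xs => f u (xs k) (xs k')]
  simp only [ev_iid_apply₂ (hS _) hk]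

/-- Codewords of different clouds are fully independent. -/
lemma ev_book_cloud (hP : P ∈ stdSimplex ℝ U) (hS : ∀ u, S u ∈ stdSimplex ℝ X) {i i' : I}
    (hi : i ≠ i') (k k' : K) (f : U → X → U → X → ℝ) :
    ev (bookLaw P S) (fun c : I → U × (K → X) =>
        f (c i).1 ((c i).2 k) (c i').1 ((c i').2 k')) =
      ev P fun u => ev (S u) fun x => ev P fun u' => ev (S u') fun x' => f u x u' x' := by
  rw [bookLaw, ev_iid_apply₂ (cluster_mem hP hS) hi fun a b => f a.1 (a.2 k) b.1 (b.2 k'),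
    ev_cluster fun u xs => ev _ fun b : U × (K → X) => f u (xs k) b.1 (b.2 k')]
  simp only [fun u (xs : K → X) => ev_cluster (P := P) (S := S)
    fun u' (xs' : K → X) => f u (xs k) u' (xs' k'), ev_iid_apply (hS _)]
  congr 1; funext u
  exact ev_iid_apply (hS u) k fun x => ev P fun u' => ev (S u') fun x' => f u x u' x'

end Book

/-! ### Threshold decoding of a superposition code. -/

section Test

variable {I K U X Y : Type*} [Fintype I] [Fintype K] [Fintype U] [Fintype X] [Fintype Y]
  [DecidableEq I] [DecidableEq K] {P : U → ℝ} {S : U → X → ℝ} {V : U → X → Y → ℝ} {t₁ t₂ : ℝ}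

/-- The law of the output given the cloud center. -/
def outC (S : U → X → ℝ) (V : U → X → Y → ℝ) (u : U) (y : Y) : ℝ := ev (S u) fun x => V u x y

/-- The law of the output. -/
def out (P : U → ℝ) (S : U → X → ℝ) (V : U → X → Y → ℝ) (y : Y) : ℝ := ev P fun u => outC S V u y

/-- The threshold test that compares the likelihood of the output with its likelihood given the
cloud center and with its unconditional likelihood. -/
def Test (P : U → ℝ) (S : U → X → ℝ) (V : U → X → Y → ℝ) (t₁ t₂ : ℝ) (u : U) (x : X) (y : Y) :
    Prop :=
  t₁ * outC S V u y < V u x y ∧ t₂ * out P S V y < V u x y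

/-- The probability that the transmitted codeword fails the threshold test. -/
def missProb (P : U → ℝ) (S : U → X → ℝ) (V : U → X → Y → ℝ) (t₁ t₂ : ℝ) : ℝ :=
  ev P fun u => ev (S u) fun x => ev (V u x) fun y => ind (¬Test P S V t₁ t₂ u x y)

omit [Fintype U] in
lemma outC_mem (hS : ∀ u, S u ∈ stdSimplex ℝ X) (hV : ∀ u x, V u x ∈ stdSimplex ℝ Y) (u : U) :
    outC S V u ∈ stdSimplex ℝ Y :=
  ev_mem_stdSimplex (hS u) (hV u)

/-- Change of measure: on the event `T`, `w` is below `v / t`, and `v` has total mass one. -/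
lemma ev_ind_le_of_lt {v w : Y → ℝ} {t : ℝ} (ht : 0 < t) (hv : v ∈ stdSimplex ℝ Y)
    {T : Y → Prop} (hT : ∀ y, T y → t * w y < v y) : ev w (fun y => ind (T y)) ≤ 1 / t := by
  rw [← hv.2, Finset.sum_div]
  refine Finset.sum_le_sum fun y _ => ?_
  beta_reduce
  by_cases h : T y
  · rw [ind_of h, mul_one, le_div_iff₀ ht]; linarith [hT y h]
  · rw [ind_of_not h, mul_zero]; exact div_nonneg (hv.1 y) ht.le

lemma ev_le_of_le {Ω : Type*} [Fintype Ω] {μ f : Ω → ℝ} {a : ℝ} (hμ : μ ∈ stdSimplex ℝ Ω)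
    (h : ∀ ω, f ω ≤ a) : ev μ f ≤ a :=
  (ev_mono hμ.1 h).trans_eq (ev_const hμ a)

/-- A wrong satellite codeword passes the test with probability at most `1 / t₁`. -/
lemma satellite_le (hP : P ∈ stdSimplex ℝ U) (hS : ∀ u, S u ∈ stdSimplex ℝ X)
    (hV : ∀ u x, V u x ∈ stdSimplex ℝ Y) (ht : 0 < t₁) :
    (ev P fun u => ev (S u) fun x => ev (outC S V u) fun y => ind (Test P S V t₁ t₂ u x y)) ≤
      1 / t₁ :=
  ev_le_of_le hP fun u => ev_le_of_le (hS u) fun x => ev_ind_le_of_lt ht (hV u x) fun _ h => h.1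

/-- A codeword around a wrong cloud center passes the test with probability at most `1 / t₂`. -/
lemma cloud_le (hP : P ∈ stdSimplex ℝ U) (hS : ∀ u, S u ∈ stdSimplex ℝ X)
    (hV : ∀ u x, V u x ∈ stdSimplex ℝ Y) (ht : 0 < t₂) :
    (ev P fun u => ev (S u) fun x => ev (out P S V) fun y => ind (Test P S V t₁ t₂ u x y)) ≤
      1 / t₂ :=
  ev_le_of_le hP fun u => ev_le_of_le (hS u) fun x => ev_ind_le_of_lt ht (hV u x) fun _ h => h.2

-- The decoder returns any message that passes, or an arbitrary one if none does. It therefore errs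
-- only if the true message fails or a wrong one passes.
omit [Fintype Y] in
lemma exists_decoder {M : Type*} [Nonempty M] (T : M → Y → Prop) :
    ∃ d : Y → M, ∀ y m, d y ≠ m → ¬T m y ∨ ∃ m', m' ≠ m ∧ T m' y := by
  classical
  refine ⟨fun y => if h : ∃ m, T m y then h.choose else Classical.arbitrary M, fun y m hd => ?_⟩
  by_cases hT : T m y
  · have h : ∃ m, T m y := ⟨m, hT⟩
    simp only [h, dif_pos] at hd
    exact Or.inr ⟨_, hd, h.choose_spec⟩
  · exact Or.inl hT

/-- A receiver that decodes the cloud center and the satellite codeword. -/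
lemma exists_superposition_decoder [Nonempty I] [Nonempty K] (hP : P ∈ stdSimplex ℝ U)
    (hS : ∀ u, S u ∈ stdSimplex ℝ X) (hV : ∀ u x, V u x ∈ stdSimplex ℝ Y) (ht₁ : 0 < t₁)
    (ht₂ : 0 < t₂) :
    ∃ d : (I → U × (K → X)) → Y → I × K, ∀ i k,
      (ev (bookLaw P S) fun c => ev (V (c i).1 ((c i).2 k)) fun y => ind (d c y ≠ (i, k))) ≤
        missProb P S V t₁ t₂ + (Fintype.card K - 1) / t₁ +
          (Fintype.card I - 1) * Fintype.card K / t₂ := by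
  choose d hd using fun c : I → U × (K → X) =>
    exists_decoder fun (m : I × K) y => Test P S V t₁ t₂ (c m.1).1 ((c m.1).2 m.2) y
  refine ⟨d, fun i k => ?_⟩
  have hb := bookLaw_mem (I := I) (K := K) hP hS
  set T := Test P S V t₁ t₂
  -- Union bound. Wrong codewords are grouped by whether they share the transmitted cloud center,
  -- since this decides how they depend on the output.
  have key : ∀ c y, ind (d c y ≠ (i, k)) ≤ ind (¬T (c i).1 ((c i).2 k) y) +
      ∑ k' ∈ Finset.univ.erase k, ind (T (c i).1 ((c i).2 k') y) +
      ∑ i' ∈ Finset.univ.erase i, ∑ k', ind (T (c i').1 ((c i').2 k') y) := by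
    intro c y
    refine (ind_mono (q := (¬T (c i).1 ((c i).2 k) y ∨
      ∃ k' ∈ Finset.univ.erase k, T (c i).1 ((c i).2 k') y) ∨
      ∃ i' ∈ Finset.univ.erase i, ∃ k' ∈ Finset.univ, T (c i').1 ((c i').2 k') y) ?_).trans ?_
    · intro h₀
      rcases hd c y _ h₀ with h | ⟨⟨i', k'⟩, hne, h⟩
      · exact Or.inl (Or.inl h)
      · by_cases hi : i' = i
        · subst hi
          exact Or.inl (Or.inr ⟨k', by simpa using hne, h⟩)
        · exact Or.inr ⟨i', by simpa using hi, k', Finset.mem_univ _, h⟩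
    · refine (ind_or_le _ _).trans (add_le_add ((ind_or_le _ _).trans
        (add_le_add le_rfl (ind_exists_le _ _))) ((ind_exists_le _ _).trans ?_))
      exact Finset.sum_le_sum fun _ _ => ind_exists_le _ _
  refine (ev_mono hb.1 fun c => ev_mono (hV _ _).1 fun y => key c y).trans ?_
  simp only [ev_add, ev_sum]
  refine add_le_add (add_le_add ?_ ?_) ?_
  · exact (ev_book hP hS i k fun u x => ev (V u x) fun y => ind (¬T u x y)).le
  · have : ∀ k' ∈ Finset.univ.erase k, (ev (bookLaw P S) fun c : I → U × (K → X) =>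
        ev (V (c i).1 ((c i).2 k)) fun y => ind (T (c i).1 ((c i).2 k') y)) ≤ 1 / t₁ := by
      intro k' hk'
      rw [ev_book_satellite hP hS i (Finset.ne_of_mem_erase hk').symm
        fun u x x' => ev (V u x) fun y => ind (T u x' y)]
      -- Given `u`, the tested satellite is independent of the transmitted one; averaging over the
      -- latter makes `outC S V u` the output law.
      refine le_trans (le_of_eq ?_) (satellite_le (t₂ := t₂) hP hS hV ht₁)
      congr 1; funext u
      rw [ev_comm]
      congr 1; funext x'
      exact (ev_ev (S u) (V u) _).symm
    refine (Finset.sum_le_sum this).trans_eq ?_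
    rw [Finset.sum_const, Finset.card_erase_of_mem (Finset.mem_univ _), Finset.card_univ,
      nsmul_eq_mul, Nat.cast_pred Fintype.card_pos, mul_one_div]
  · have : ∀ i' ∈ Finset.univ.erase i, ∀ k' ∈ Finset.univ,
        (ev (bookLaw P S) fun c : I → U × (K → X) =>
        ev (V (c i).1 ((c i).2 k)) fun y => ind (T (c i').1 ((c i').2 k') y)) ≤ 1 / t₂ := by
      intro i' hi' k' _
      rw [ev_book_cloud hP hS (Finset.ne_of_mem_erase hi').symm k k'
        fun u x u' x' => ev (V u x) fun y => ind (T u' x' y)]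
      -- The tested codeword is independent of the whole transmitted pair, so the output law becomes
      -- `out P S V`.
      refine le_trans (le_of_eq ?_) (cloud_le (t₁ := t₁) hP hS hV ht₂)
      simp only [fun u => ev_comm (S u) P]
      rw [ev_comm]
      congr 1; funext u'
      simp only [fun u => ev_comm (S u) (S u')]
      rw [ev_comm]
      congr 1; funext x'
      simp only [← ev_ev]
      rfl
    refine (Finset.sum_le_sum fun i' hi' => Finset.sum_le_sum (this i' hi')).trans_eq ?_
    simp only [Finset.sum_const]
    rw [Finset.card_erase_of_mem (Finset.mem_univ _), Finset.card_univ, Finset.card_univ,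
      nsmul_eq_mul, nsmul_eq_mul, Nat.cast_pred Fintype.card_pos]
    ring

end Test

/-! ### Decoding one cloud center in the presence of interference. -/

section Interference

variable {I K J L U₁ X₁ U₂ X₂ Y : Type*} [Fintype I] [Fintype K] [Fintype J] [Fintype L]
  [Fintype U₁] [Fintype X₁] [Fintype U₂] [Fintype X₂] [Fintype Y]
  [DecidableEq I] [DecidableEq K] [DecidableEq J] [DecidableEq L]
  {P₁ : U₁ → ℝ} {S₁ : U₁ → X₁ → ℝ} {P₂ : U₂ → ℝ} {S₂ : U₂ → X₂ → ℝ}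
  {V : X₁ → X₂ → Y → ℝ} {t₁ t₂ : ℝ}

/-- The channel from the two cloud centers to the output. -/
def cloudChannel (S₁ : U₁ → X₁ → ℝ) (S₂ : U₂ → X₂ → ℝ) (V : X₁ → X₂ → Y → ℝ) (u₂ : U₂) (u₁ : U₁)
    (y : Y) : ℝ :=
  ev (S₁ u₁) fun x₁ => ev (S₂ u₂) fun x₂ => V x₁ x₂ y

omit [Fintype U₁] [Fintype U₂] in
lemma cloudChannel_mem (hS₁ : ∀ u, S₁ u ∈ stdSimplex ℝ X₁) (hS₂ : ∀ u, S₂ u ∈ stdSimplex ℝ X₂)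
    (hV : ∀ x₁ x₂, V x₁ x₂ ∈ stdSimplex ℝ Y) (u₂ : U₂) (u₁ : U₁) :
    cloudChannel S₁ S₂ V u₂ u₁ ∈ stdSimplex ℝ Y :=
  ev_mem_stdSimplex (hS₁ u₁) fun x₁ => ev_mem_stdSimplex (hS₂ u₂) (hV x₁)

omit [Fintype U₁] [Fintype U₂] in
lemma ev_cloudChannel (u₂ : U₂) (u₁ : U₁) (f : Y → ℝ) :
    ev (cloudChannel S₁ S₂ V u₂ u₁) f =
      ev (S₁ u₁) fun x₁ => ev (S₂ u₂) fun x₂ => ev (V x₁ x₂) f := by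
  refine (ev_ev (S₁ u₁) _ f).trans ?_
  congr 1; funext x₁
  exact ev_ev (S₂ u₂) (V x₁) f

/-- A receiver that decodes the cloud center of sender 1 with the help of the cloud center of
sender 2. -/
lemma exists_interference_decoder [Nonempty I] [Nonempty J] (hP₁ : P₁ ∈ stdSimplex ℝ U₁)
    (hS₁ : ∀ u, S₁ u ∈ stdSimplex ℝ X₁) (hP₂ : P₂ ∈ stdSimplex ℝ U₂)
    (hS₂ : ∀ u, S₂ u ∈ stdSimplex ℝ X₂) (hV : ∀ x₁ x₂, V x₁ x₂ ∈ stdSimplex ℝ Y)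
    (ht₁ : 0 < t₁) (ht₂ : 0 < t₂) :
    ∃ d : (I → U₁ × (K → X₁)) → (J → U₂ × (L → X₂)) → Y → I, ∀ i k j l,
      (ev (bookLaw P₁ S₁) fun c₁ => ev (bookLaw P₂ S₂) fun c₂ =>
        ev (V ((c₁ i).2 k) ((c₂ j).2 l)) fun y => ind (d c₁ c₂ y ≠ i)) ≤
        missProb P₂ (fun _ => P₁) (cloudChannel S₁ S₂ V) t₁ t₂ +
          (Fintype.card I - 1) / t₁ + (Fintype.card J - 1) * (Fintype.card I - 1) / t₂ := by
  set Q := cloudChannel S₁ S₂ V with hQ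
  -- The same test in other roles: u₂ is the cloud and u₁ a satellite whose law does not depend on
  -- it. Both channel inputs are averaged into the noise of `Q`.
  set T := Test P₂ (fun _ => P₁) Q t₁ t₂ with hT
  have hQm : ∀ u₂ u₁, Q u₂ u₁ ∈ stdSimplex ℝ Y := cloudChannel_mem hS₁ hS₂ hV
  -- Non-unique decoding: some `j` has to fit, but a wrong `j` with the right `i` is no error. Hence
  -- only the `i' ≠ i` are counted in both sums below.
  choose d hd using fun (c₁ : I → U₁ × (K → X₁)) (c₂ : J → U₂ × (L → X₂)) =>
    exists_decoder fun i y => ∃ j, T (c₂ j).1 (c₁ i).1 y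
  refine ⟨d, fun i k j l => ?_⟩
  have hb₁ := bookLaw_mem (I := I) (K := K) hP₁ hS₁
  have hb₂ := bookLaw_mem (I := J) (K := L) hP₂ hS₂
  have key : ∀ c₁ c₂ y, ind (d c₁ c₂ y ≠ i) ≤ ind (¬T (c₂ j).1 (c₁ i).1 y) +
      ∑ i' ∈ Finset.univ.erase i, ind (T (c₂ j).1 (c₁ i').1 y) +
      ∑ j' ∈ Finset.univ.erase j, ∑ i' ∈ Finset.univ.erase i, ind (T (c₂ j').1 (c₁ i').1 y) := by
    intro c₁ c₂ y
    refine (ind_mono (q := (¬T (c₂ j).1 (c₁ i).1 y ∨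
      ∃ i' ∈ Finset.univ.erase i, T (c₂ j).1 (c₁ i').1 y) ∨
      ∃ j' ∈ Finset.univ.erase j, ∃ i' ∈ Finset.univ.erase i, T (c₂ j').1 (c₁ i').1 y)
      ?_).trans ?_
    · intro h₀
      rcases hd c₁ c₂ y _ h₀ with h | ⟨i', hi, j', h⟩
      · exact Or.inl (Or.inl fun h' => h ⟨j, h'⟩)
      · by_cases hj : j' = j
        · subst hj
          exact Or.inl (Or.inr ⟨i', by simpa using hi, h⟩)
        · exact Or.inr ⟨j', by simpa using hj, i', by simpa using hi, h⟩
    · refine (ind_or_le _ _).trans (add_le_add ((ind_or_le _ _).trans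
        (add_le_add le_rfl (ind_exists_le _ _))) ((ind_exists_le _ _).trans ?_))
      exact Finset.sum_le_sum fun _ _ => ind_exists_le _ _
  refine (ev_mono hb₁.1 fun c₁ => ev_mono hb₂.1 fun c₂ =>
    ev_mono (hV _ _).1 fun y => key c₁ c₂ y).trans ?_
  simp only [ev_add, ev_sum]
  refine add_le_add (add_le_add ?_ ?_) ?_
  · simp only [fun x₁ u₁ => ev_book hP₂ hS₂ j l fun u₂ x₂ =>
      ev (V x₁ x₂) fun y => ind (¬T u₂ u₁ y)]
    rw [ev_book hP₁ hS₁ i k fun u₁ x₁ => ev P₂ fun u₂ => ev (S₂ u₂) fun x₂ =>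
      ev (V x₁ x₂) fun y => ind (¬T u₂ u₁ y)]
    simp only [fun u₁ => ev_comm (S₁ u₁) P₂, ← ev_cloudChannel]
    rw [ev_comm]
    exact le_rfl
  · have : ∀ i' ∈ Finset.univ.erase i,
        (ev (bookLaw P₁ S₁) fun c₁ : I → U₁ × (K → X₁) =>
        ev (bookLaw P₂ S₂) fun c₂ : J → U₂ × (L → X₂) =>
        ev (V ((c₁ i).2 k) ((c₂ j).2 l)) fun y => ind (T (c₂ j).1 (c₁ i').1 y)) ≤ 1 / t₁ := by
      intro i' hi'
      simp only [fun x₁ u₁ => ev_book hP₂ hS₂ j l fun u₂ x₂ =>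
        ev (V x₁ x₂) fun y => ind (T u₂ u₁ y)]
      rw [ev_book_cloud hP₁ hS₁ (Finset.ne_of_mem_erase hi').symm k k fun u₁ x₁ u₁' x₁' =>
        ev P₂ fun u₂ => ev (S₂ u₂) fun x₂ => ev (V x₁ x₂) fun y => ind (T u₂ u₁' y)]
      refine le_trans (le_of_eq ?_) (satellite_le (t₂ := t₂) hP₂ (fun _ => hP₁) hQm ht₁)
      simp only [ev_const (hS₁ _), fun u₁ => ev_comm (S₁ u₁) P₁]
      simp only [fun u₁ => ev_comm (S₁ u₁) P₂, ← ev_cloudChannel]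
      rw [ev_comm]
      simp only [ev_comm P₁ P₂]
      congr 1; funext u₂
      congr 1; funext u₁'
      exact (ev_ev P₁ (Q u₂) _).symm
    refine (Finset.sum_le_sum this).trans_eq ?_
    rw [Finset.sum_const, Finset.card_erase_of_mem (Finset.mem_univ _), Finset.card_univ,
      nsmul_eq_mul, Nat.cast_pred Fintype.card_pos, mul_one_div]
  · have : ∀ j' ∈ Finset.univ.erase j, ∀ i' ∈ Finset.univ.erase i,
        (ev (bookLaw P₁ S₁) fun c₁ : I → U₁ × (K → X₁) =>
        ev (bookLaw P₂ S₂) fun c₂ : J → U₂ × (L → X₂) =>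
        ev (V ((c₁ i).2 k) ((c₂ j).2 l)) fun y => ind (T (c₂ j').1 (c₁ i').1 y)) ≤ 1 / t₂ := by
      intro j' hj' i' hi'
      simp only [fun x₁ u₁ => ev_book_cloud hP₂ hS₂ (Finset.ne_of_mem_erase hj').symm l l
        fun u₂ x₂ u₂' x₂' => ev (V x₁ x₂) fun y => ind (T u₂' u₁ y)]
      rw [ev_book_cloud hP₁ hS₁ (Finset.ne_of_mem_erase hi').symm k k fun u₁ x₁ u₁' x₁' =>
        ev P₂ fun u₂ => ev (S₂ u₂) fun x₂ => ev P₂ fun u₂' => ev (S₂ u₂') fun x₂' =>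
          ev (V x₁ x₂) fun y => ind (T u₂' u₁' y)]
      refine le_trans (le_of_eq ?_) (cloud_le (t₁ := t₁) hP₂ (fun _ => hP₁) hQm ht₂)
      simp only [ev_const (hS₁ _), ev_const (hS₂ _), fun u₂ => ev_comm (S₂ u₂) P₂]
      simp only [fun u₁ => ev_comm (S₁ u₁) P₁]
      simp only [fun u₁ => ev_comm (S₁ u₁) P₂, ← ev_cloudChannel]
      have h : ∀ f : Y → ℝ, ev (out P₂ (fun _ => P₁) Q) f =
          ev P₁ fun u₁ => ev P₂ fun u₂ => ev (Q u₂ u₁) f := by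
        intro f
        rw [ev_comm]
        refine (ev_ev P₂ _ f).trans ?_
        congr 1; funext u₂
        exact ev_ev P₁ (Q u₂) f
      rw [ev_comm]
      simp only [ev_comm P₁ P₂]
      rw [ev_comm P₂ P₂]
      congr 1; funext u₂'
      rw [ev_comm]
      congr 1; funext u₁'
      rw [h, ev_comm]
    refine (Finset.sum_le_sum fun i' hi' => Finset.sum_le_sum (this i' hi')).trans_eq ?_
    simp only [Finset.sum_const]
    rw [Finset.card_erase_of_mem (Finset.mem_univ _), Finset.card_erase_of_mem (Finset.mem_univ _),
      Finset.card_univ, Finset.card_univ,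
      nsmul_eq_mul, nsmul_eq_mul, Nat.cast_pred Fintype.card_pos, Nat.cast_pred Fintype.card_pos]
    ring

end Interference

/-! ### Random coding for a single channel use. -/

section OneShot

variable {A₁ A₂ B₁ B₂ B₃ U₁ U₂ I₁ I₂ J K : Type*} [Fintype A₁] [Fintype A₂] [Fintype B₁]
  [Fintype B₂] [Fintype B₃] [Fintype U₁] [Fintype U₂] [Fintype I₁] [Fintype I₂] [Fintype J]
  [Fintype K]

/-- Derandomization: a good average over codebooks yields one good codebook. -/
lemma exists_le_of_ev_le {Ω : Type*} [Fintype Ω] {μ f : Ω → ℝ} {a : ℝ} (hμ : μ ∈ stdSimplex ℝ Ω)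
    (h : ev μ f ≤ a) : ∃ ω, f ω ≤ a := by
  by_contra! hlt
  have hle : ∀ ω ∈ Finset.univ, μ ω * a ≤ μ ω * f ω := fun ω _ =>
    mul_le_mul_of_nonneg_left (hlt ω).le (hμ.1 ω)
  obtain ⟨ω, hω⟩ : ∃ ω, 0 < μ ω := by
    by_contra! h0
    have := Finset.sum_nonpos fun ω (_ : ω ∈ Finset.univ) => h0 ω
    rw [hμ.2] at this
    linarith
  have := Finset.sum_lt_sum hle ⟨ω, Finset.mem_univ _, mul_lt_mul_of_pos_left (hlt ω) hω⟩
  have h1 : ∑ ω, μ ω * a = a := ev_const hμ a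
  unfold ev at h
  linarith

lemma ev_ev_add {Ω Ω' : Type*} [Fintype Ω] [Fintype Ω'] {p : Ω → ℝ} {q : Ω' → ℝ}
    (hp : p ∈ stdSimplex ℝ Ω) (hq : q ∈ stdSimplex ℝ Ω') (f : Ω → ℝ) (g : Ω → Ω' → ℝ)
    (h : Ω' → ℝ) :
    ev p (fun a => ev q fun b => f a + g a b + h b) =
      ev p f + ev p (fun a => ev q (g a)) + ev q h := by
  simp only [ev_add, ev_const hq]
  rw [ev_const hp]

omit [Fintype A₁] [Fintype A₂] in
lemma ev_trans (W : Channel A₁ A₂ B₁ B₂ B₃) (x₁ : A₁) (x₂ : A₂) (f : B₁ × B₂ × B₃ → ℝ) :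
    ev (W.trans x₁ x₂) f = ev (W.p₁ x₁) fun y₁ => ev (W.p₂ x₁ x₂) fun y₂ =>
      ev (W.p₃ x₂) fun y₃ => f (y₁, y₂, y₃) := by
  have : W.trans x₁ x₂ = fun y : B₁ × B₂ × B₃ => W.p₁ x₁ y.1 * (W.p₂ x₁ x₂ y.2.1 * W.p₃ x₂ y.2.2) :=
    funext fun y => mul_assoc _ _ _
  rw [this, ev_prod (W.p₁ x₁) fun _ (y : B₂ × B₃) => W.p₂ x₁ x₂ y.1 * W.p₃ x₂ y.2]
  congr 1; funext y₁
  exact ev_prod (W.p₂ x₁ x₂) (fun _ => W.p₃ x₂) _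

omit [Fintype A₁] [Fintype A₂] in
lemma trans_mem (W : Channel A₁ A₂ B₁ B₂ B₃) (x₁ : A₁) (x₂ : A₂) :
    W.trans x₁ x₂ ∈ stdSimplex ℝ (B₁ × B₂ × B₃) := by
  refine ⟨fun y => mul_nonneg (mul_nonneg ((W.p₁_mem _).1 _) ((W.p₂_mem _ _).1 _))
    ((W.p₃_mem _).1 _), ?_⟩
  have := ev_trans W x₁ x₂ fun _ => 1
  simp only [ev_const (W.p₁_mem _), ev_const (W.p₂_mem _ _), ev_const (W.p₃_mem _)] at this
  simpa [ev] using this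

omit [Fintype A₁] [Fintype A₂] in
lemma ev_trans_ind_or_le (W : Channel A₁ A₂ B₁ B₂ B₃) (x₁ : A₁) (x₂ : A₂) (p₁ : B₁ → Prop)
    (p₂ : B₂ → Prop) (p₃ : B₃ → Prop) :
    ev (W.trans x₁ x₂) (fun y => ind (p₁ y.1 ∨ p₂ y.2.1 ∨ p₃ y.2.2)) ≤
      ev (W.p₁ x₁) (fun y => ind (p₁ y)) + ev (W.p₂ x₁ x₂) (fun y => ind (p₂ y)) +
        ev (W.p₃ x₂) (fun y => ind (p₃ y)) := by
  have h : ∀ y : B₁ × B₂ × B₃, ind (p₁ y.1 ∨ p₂ y.2.1 ∨ p₃ y.2.2) ≤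
      ind (p₁ y.1) + ind (p₂ y.2.1) + ind (p₃ y.2.2) := fun y => by
    have h₁ := ind_or_le (p₁ y.1) (p₂ y.2.1 ∨ p₃ y.2.2)
    have h₂ := ind_or_le (p₂ y.2.1) (p₃ y.2.2)
    linarith
  refine (ev_mono (trans_mem W x₁ x₂).1 h).trans_eq ?_
  simp only [ev_add, ev_trans, ev_const (W.p₁_mem _), ev_const (W.p₂_mem _ _),
    ev_const (W.p₃_mem _)]

/-- Random coding bound for a single use of a broadcast interference channel. -/
theorem exists_one_shot_code [Nonempty I₁] [Nonempty I₂] [Nonempty J] [Nonempty K]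
    (W : Channel A₁ A₂ B₁ B₂ B₃) {P₁ : U₁ → ℝ} {S₁ : U₁ → A₁ → ℝ} {P₂ : U₂ → ℝ} {S₂ : U₂ → A₂ → ℝ}
    (hP₁ : P₁ ∈ stdSimplex ℝ U₁) (hS₁ : ∀ u, S₁ u ∈ stdSimplex ℝ A₁)
    (hP₂ : P₂ ∈ stdSimplex ℝ U₂) (hS₂ : ∀ u, S₂ u ∈ stdSimplex ℝ A₂)
    {a₁ a₂ b₁ b₂ c₁ c₂ : ℝ} (ha₁ : 0 < a₁) (ha₂ : 0 < a₂) (hb₁ : 0 < b₁) (hb₂ : 0 < b₂)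
    (hc₁ : 0 < c₁) (hc₂ : 0 < c₂) :
    ∃ (e₁ : I₁ → I₂ → A₁) (e₂ : J × K → A₂) (d₁ : B₁ → I₁) (d₂ : B₂ → I₂) (d₃ : B₃ → J × K),
      (∑ w₁, ∑ w₂, ∑ w₃, ev (W.trans (e₁ w₁ w₂) (e₂ w₃)) fun y =>
        ind (d₁ y.1 ≠ w₁ ∨ d₂ y.2.1 ≠ w₂ ∨ d₃ y.2.2 ≠ w₃)) ≤
      Fintype.card I₁ * (Fintype.card I₂ * (Fintype.card (J × K) * (
        (missProb P₁ S₁ (fun _ => W.p₁) a₁ a₂ + (Fintype.card I₁ - 1) / a₁ +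
          (Fintype.card I₂ - 1) * Fintype.card I₁ / a₂) +
        (missProb P₂ (fun _ => P₁) (cloudChannel S₁ S₂ W.p₂) b₁ b₂ + (Fintype.card I₂ - 1) / b₁ +
          (Fintype.card J - 1) * (Fintype.card I₂ - 1) / b₂) +
        (missProb P₂ S₂ (fun _ => W.p₃) c₁ c₂ + (Fintype.card K - 1) / c₁ +
          (Fintype.card J - 1) * Fintype.card K / c₂)))) := by
  classical
  set E₁ := missProb P₁ S₁ (fun _ => W.p₁) a₁ a₂ + (Fintype.card I₁ - 1) / a₁ +
          (Fintype.card I₂ - 1) * Fintype.card I₁ / a₂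
  set E₂ := missProb P₂ (fun _ => P₁) (cloudChannel S₁ S₂ W.p₂) b₁ b₂ +
    (Fintype.card I₂ - 1) / b₁ + (Fintype.card J - 1) * (Fintype.card I₂ - 1) / b₂
  set E₃ := missProb P₂ S₂ (fun _ => W.p₃) c₁ c₂ + (Fintype.card K - 1) / c₁ +
          (Fintype.card J - 1) * Fintype.card K / c₂
  obtain ⟨d₁, hd₁⟩ := exists_superposition_decoder (I := I₂) (K := I₁) hP₁ hS₁
    (fun _ => W.p₁_mem) ha₁ ha₂
  obtain ⟨d₂, hd₂⟩ := exists_interference_decoder (I := I₂) (K := I₁) (J := J) (L := K) hP₁ hS₁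
    hP₂ hS₂ W.p₂_mem hb₁ hb₂
  obtain ⟨d₃, hd₃⟩ := exists_superposition_decoder (I := J) (K := K) hP₂ hS₂
    (fun _ => W.p₃_mem) hc₁ hc₂
  have hB₁ := bookLaw_mem (I := I₂) (K := I₁) hP₁ hS₁
  have hB₂ := bookLaw_mem (I := J) (K := K) hP₂ hS₂
  have key : (ev (bookLaw P₁ S₁) fun C₁ : I₂ → U₁ × (I₁ → A₁) =>
      ev (bookLaw P₂ S₂) fun C₂ : J → U₂ × (K → A₂) => ∑ w₁, ∑ w₂, ∑ w₃ : J × K,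
        ev (W.trans ((C₁ w₂).2 w₁) ((C₂ w₃.1).2 w₃.2)) fun y =>
        ind ((d₁ C₁ y.1).2 ≠ w₁ ∨ d₂ C₁ C₂ y.2.1 ≠ w₂ ∨ d₃ C₂ y.2.2 ≠ w₃)) ≤
      ∑ _w₁ : I₁, ∑ _w₂ : I₂, ∑ _w₃ : J × K, (E₁ + E₂ + E₃) := by
    simp only [ev_sum]
    refine Finset.sum_le_sum fun w₁ _ => Finset.sum_le_sum fun w₂ _ =>
      Finset.sum_le_sum fun w₃ _ => ?_
    refine (ev_mono hB₁.1 fun C₁ => ev_mono hB₂.1 fun C₂ => ev_trans_ind_or_le W _ _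
      (fun y => (d₁ C₁ y).2 ≠ w₁) (fun y => d₂ C₁ C₂ y ≠ w₂) (fun y => d₃ C₂ y ≠ w₃)).trans ?_
    refine (ev_ev_add hB₁ hB₂
      (fun C₁ => ev (W.p₁ ((C₁ w₂).2 w₁)) fun y => ind ((d₁ C₁ y).2 ≠ w₁))
      (fun C₁ C₂ => ev (W.p₂ ((C₁ w₂).2 w₁) ((C₂ w₃.1).2 w₃.2)) fun y => ind (d₂ C₁ C₂ y ≠ w₂))
      (fun C₂ => ev (W.p₃ ((C₂ w₃.1).2 w₃.2)) fun y => ind (d₃ C₂ y ≠ w₃))).trans_le ?_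
    refine add_le_add (add_le_add (le_trans ?_ (hd₁ w₂ w₁)) (hd₂ w₂ w₁ w₃.1 w₃.2))
      (hd₃ w₃.1 w₃.2)
    -- Receiver 1 only needs `w₁`; its error is bounded by the failure to recover the pair `(w₂,
    -- w₁)`.
    refine ev_mono hB₁.1 fun C₁ => ev_mono (W.p₁_mem _).1 fun y => ind_mono fun h h' => h ?_
    rw [h']
  obtain ⟨C₁, h⟩ := exists_le_of_ev_le hB₁ key
  obtain ⟨C₂, h⟩ := exists_le_of_ev_le hB₂ h
  refine ⟨fun w₁ w₂ => (C₁ w₂).2 w₁, fun w₃ => (C₂ w₃.1).2 w₃.2, fun y => (d₁ C₁ y).2,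
    d₂ C₁ C₂, d₃ C₂, h.trans_eq ?_⟩
  simp only [Finset.sum_const, Finset.card_univ, nsmul_eq_mul]

end OneShot

/-! ### Memoryless uses as one use of a product channel. -/

section Power

variable {X₁ X₂ Y₁ Y₂ Y₃ : Type*} [Fintype X₁] [Fintype X₂] [Fintype Y₁] [Fintype Y₂] [Fintype Y₃]

/-- The product of independent laws. -/
def piLaw {α β : Type*} (κ : α → β → ℝ) {n : ℕ} (a : Fin n → α) (b : Fin n → β) : ℝ :=
  ∏ i, κ (a i) (b i)

lemma piLaw_mem {α β : Type*} [Fintype β] {κ : α → β → ℝ} (hκ : ∀ a, κ a ∈ stdSimplex ℝ β) {n : ℕ}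
    (a : Fin n → α) : piLaw κ a ∈ stdSimplex ℝ (Fin n → β) := by
  refine ⟨fun b => Finset.prod_nonneg fun i _ => (hκ _).1 _, ?_⟩
  refine (sum_pi_prod fun i => κ (a i)).trans ?_
  simp [(hκ _).2]

/-- The channel that consists of `n` memoryless uses. -/
def Channel.pow (W : Channel X₁ X₂ Y₁ Y₂ Y₃) (n : ℕ) :
    Channel (Fin n → X₁) (Fin n → X₂) (Fin n → Y₁) (Fin n → Y₂) (Fin n → Y₃) where
  p₁ := piLaw W.p₁
  p₂ x₁ x₂ := piLaw (fun x : X₁ × X₂ => W.p₂ x.1 x.2) fun i => (x₁ i, x₂ i)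
  p₃ := piLaw W.p₃
  p₁_mem := piLaw_mem W.p₁_mem
  p₂_mem _ _ := piLaw_mem (fun _ => W.p₂_mem _ _) _
  p₃_mem := piLaw_mem W.p₃_mem

omit [Fintype X₁] [Fintype X₂] in
lemma pow_trans (W : Channel X₁ X₂ Y₁ Y₂ Y₃) (n : ℕ) (x₁ : Fin n → X₁) (x₂ : Fin n → X₂)
    (y : (Fin n → Y₁) × (Fin n → Y₂) × (Fin n → Y₃)) :
    (W.pow n).trans x₁ x₂ y = ∏ i, W.trans (x₁ i) (x₂ i) (y.1 i, y.2.1 i, y.2.2 i) := by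
  simp only [Channel.trans, Finset.prod_mul_distrib]
  rfl

variable {U₁ U₂ : Type*} [Fintype U₁] [Fintype U₂]

/-- Random coding bound for `n` memoryless uses of a broadcast interference channel. -/
theorem exists_code (W : Channel X₁ X₂ Y₁ Y₂ Y₃) {n : ℕ} {P₁ : (Fin n → U₁) → ℝ}
    {S₁ : (Fin n → U₁) → (Fin n → X₁) → ℝ} {P₂ : (Fin n → U₂) → ℝ}
    {S₂ : (Fin n → U₂) → (Fin n → X₂) → ℝ}
    (hP₁ : P₁ ∈ stdSimplex ℝ _) (hS₁ : ∀ u, S₁ u ∈ stdSimplex ℝ _)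
    (hP₂ : P₂ ∈ stdSimplex ℝ _) (hS₂ : ∀ u, S₂ u ∈ stdSimplex ℝ _)
    {a₁ a₂ b₁ b₂ c₁ c₂ : ℝ} (ha₁ : 0 < a₁) (ha₂ : 0 < a₂) (hb₁ : 0 < b₁) (hb₂ : 0 < b₂)
    (hc₁ : 0 < c₁) (hc₂ : 0 < c₂) {M₁ M₂ m l : ℕ} (hM₁ : 0 < M₁) (hM₂ : 0 < M₂) (hm : 0 < m)
    (hl : 0 < l) :
    ∃ c : Code X₁ X₂ Y₁ Y₂ Y₃ M₁ M₂ (m * l) n, W.errorProb c ≤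
        (missProb P₁ S₁ (fun _ => (W.pow n).p₁) a₁ a₂ + (M₁ - 1) / a₁ + (M₂ - 1) * M₁ / a₂) +
        (missProb P₂ (fun _ => P₁) (cloudChannel S₁ S₂ (W.pow n).p₂) b₁ b₂ + (M₂ - 1) / b₁ +
          (m - 1) * (M₂ - 1) / b₂) +
        (missProb P₂ S₂ (fun _ => (W.pow n).p₃) c₁ c₂ + (l - 1) / c₁ + (m - 1) * l / c₂) := by
  have : NeZero M₁ := ⟨hM₁.ne'⟩
  have : NeZero M₂ := ⟨hM₂.ne'⟩
  have : NeZero m := ⟨hm.ne'⟩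
  have : NeZero l := ⟨hl.ne'⟩
  obtain ⟨e₁, e₂, d₁, d₂, d₃, h⟩ := exists_one_shot_code (I₁ := Fin M₁) (I₂ := Fin M₂) (J := Fin m)
    (K := Fin l) (W.pow n) hP₁ hS₁ hP₂ hS₂ ha₁ ha₂ hb₁ hb₂ hc₁ hc₂
  simp only [Fintype.card_fin, Fintype.card_prod] at h
  -- `finProdFinEquiv` splits message 3 into its cloud and satellite indices.
  refine ⟨⟨e₁, fun w => e₂ (finProdFinEquiv.symm w), d₁, d₂, fun y => finProdFinEquiv (d₃ y)⟩, ?_⟩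
  have hpos : (0 : ℝ) < (M₁ : ℝ) * M₂ * (m * l : ℕ) := by positivity
  rw [Channel.errorProb, div_le_iff₀ hpos]
  refine Eq.trans_le ?_ (h.trans_eq (by ring))
  refine Finset.sum_congr rfl fun w₁ _ => Finset.sum_congr rfl fun w₂ _ => ?_
  rw [← finProdFinEquiv.sum_comp]
  refine Finset.sum_congr rfl fun w₃ _ => ?_
  simp only [ev, Fintype.sum_prod_type, pow_trans, Equiv.symm_apply_apply, ind,
    EmbeddingLike.apply_eq_iff_eq, ne_eq, mul_ite, mul_one, mul_zero]

end Power

/-! ### The transmitted codeword passes the test. -/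

section WeakLaw

variable {A B U X Y : Type*} [Fintype A] [Fintype B] [Fintype U] [Fintype X] [Fintype Y]

/-- Cross terms vanish by independence and zero mean; this is the variance for Chebyshev's
inequality. -/
lemma ev_iid_sum_sq {q : A → ℝ} (hq : q ∈ stdSimplex ℝ A) {h : A → ℝ} (h0 : ev q h = 0) (n : ℕ) :
    ev (iid q) (fun ω : Fin n → A => (∑ i, h (ω i)) ^ 2) = n * ev q fun a => h a ^ 2 := by
  simp only [sq, Finset.sum_mul_sum, ev_sum]
  have : ∀ i j : Fin n, ev (iid q) (fun ω : Fin n → A => h (ω i) * h (ω j)) =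
      if i = j then ev q (fun a => h a * h a) else 0 := by
    intro i j
    split_ifs with hij
    · subst hij
      exact ev_iid_apply hq i fun a => h a * h a
    · rw [ev_iid_mul hq hij h h, h0, zero_mul]
  simp [this]

/-- Weak law of large numbers for likelihood ratios. -/
lemma exists_ev_iid_ratio_le {q f g : A → ℝ} (hq : q ∈ stdSimplex ℝ A) (hf : ∀ a, 0 < q a → 0 < f a)
    (hg : ∀ a, 0 < q a → 0 < g a) {δ : ℝ} (hδ : 0 < δ) :
    ∃ C : ℝ, ∀ n : ℕ, 0 < n → ev (iid q) (fun ω : Fin n → A => ind (∏ i, f (ω i) ≤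
        (2 : ℝ) ^ (n * (ev q (fun a => Real.logb 2 (f a / g a)) - δ)) * ∏ i, g (ω i))) ≤
      C / n := by
  set L : A → ℝ := fun a => Real.logb 2 (f a / g a) with hL
  set m := ev q L with hm
  refine ⟨(ev q fun a => (L a - m) ^ 2) / δ ^ 2, fun n hn => ?_⟩
  have hn' : (0 : ℝ) < n := by exact_mod_cast hn
  have h0 : ev q (fun a => L a - m) = 0 := by rw [ev_sub, ev_const hq, hm, sub_self]
  -- Chebyshev, pointwise: on the event the centered log-likelihood sum is at most `-(n * δ)`, so
  -- its square over `(n * δ) ^ 2` is at least 1. Sequences containing a letter of mass zero have no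
  -- weight, so all logarithms used are of positive numbers.
  have key : ∀ ω : Fin n → A, iid q ω * ind (∏ i, f (ω i) ≤
        (2 : ℝ) ^ (n * (m - δ)) * ∏ i, g (ω i)) ≤
      iid q ω * ((∑ i, (L (ω i) - m)) ^ 2 * (1 / (n * δ) ^ 2)) := by
    intro ω
    by_cases hω : ∀ i, 0 < q (ω i)
    · refine mul_le_mul_of_nonneg_left ?_ ((iid_mem hq).1 ω)
      by_cases h : ∏ i, f (ω i) ≤ (2 : ℝ) ^ (n * (m - δ)) * ∏ i, g (ω i)
      · rw [ind_of h, mul_one_div, one_le_div (by positivity)]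
        have hF : 0 < ∏ i, f (ω i) := Finset.prod_pos fun i _ => hf _ (hω i)
        have hG : 0 < ∏ i, g (ω i) := Finset.prod_pos fun i _ => hg _ (hω i)
        have hsum : ∑ i, L (ω i) ≤ n * (m - δ) := by
          have h1 : ∑ i, L (ω i) = Real.logb 2 ((∏ i, f (ω i)) / ∏ i, g (ω i)) := by
            rw [← Finset.prod_div_distrib, Real.logb_prod]
            exact fun i _ => (div_pos (hf _ (hω i)) (hg _ (hω i))).ne'
          rw [h1, Real.logb_le_iff_le_rpow (by norm_num) (div_pos hF hG), div_le_iff₀ hG]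
          exact h
        have h2 : ∑ i, (L (ω i) - m) ≤ -(n * δ) := by
          rw [Finset.sum_sub_distrib]
          simp only [Finset.sum_const, Finset.card_univ, Fintype.card_fin, nsmul_eq_mul]
          linarith
        have h3 : 0 < n * δ := by positivity
        nlinarith
      · rw [ind_of_not h]; positivity
    · push Not at hω
      obtain ⟨i, hi⟩ := hω
      have : iid q ω = 0 := Finset.prod_eq_zero (Finset.mem_univ i) (le_antisymm hi (hq.1 _))
      simp [this]
  refine (Finset.sum_le_sum fun ω _ => key ω).trans_eq ?_
  refine (ev_mul_const (iid q) (fun ω : Fin n → A => (∑ i, (L (ω i) - m)) ^ 2) _).trans ?_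
  rw [ev_iid_sum_sq hq h0]
  field_simp

/-- The `n`-fold product of a channel with two inputs. -/
def piLaw₂ {α β γ : Type*} (V : α → β → γ → ℝ) {n : ℕ} (a : Fin n → α) (b : Fin n → β) :
    (Fin n → γ) → ℝ :=
  piLaw (fun x : α × β => V x.1 x.2) fun i => (a i, b i)

/-- Input and output sequences regroup into one i.i.d. sequence of pairs. -/
lemma ev_iid_piLaw (p : A → ℝ) (κ : A → B → ℝ) {n : ℕ} (F : (Fin n → A) → (Fin n → B) → ℝ) :
    (ev (iid p) fun a => ev (piLaw κ a) fun b => F a b) =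
      ev (iid fun ω : A × B => p ω.1 * κ ω.1 ω.2) fun ω =>
        F (fun i => (ω i).1) fun i => (ω i).2 := by
  simp only [ev, iid, piLaw, Finset.mul_sum, Finset.prod_mul_distrib]
  rw [← Fintype.sum_prod_type' (f := fun (a : Fin n → A) (b : Fin n → B) =>
    (∏ i, p (a i)) * ((∏ i, κ (a i) (b i)) * F a b)),
    ← (Equiv.arrowProdEquivProdArrow (Fin n) (fun _ => A) (fun _ => B)).sum_comp]
  exact Finset.sum_congr rfl fun ω _ => (mul_assoc _ _ _).symm

/-- The conditional mutual information between the satellite and the output given the cloud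
center. -/
def infoC (P : U → ℝ) (S : U → X → ℝ) (V : U → X → Y → ℝ) : ℝ :=
  ev P fun u => ev (S u) fun x => ev (V u x) fun y => Real.logb 2 (V u x y / outC S V u y)

/-- The mutual information between the cloud center together with the satellite and the
output. -/
def infoT (P : U → ℝ) (S : U → X → ℝ) (V : U → X → Y → ℝ) : ℝ :=
  ev P fun u => ev (S u) fun x => ev (V u x) fun y => Real.logb 2 (V u x y / out P S V y)

variable {P : U → ℝ} {S : U → X → ℝ} {V : U → X → Y → ℝ}

-- With `out_pi`, this makes the block test a comparison of products, the form needed by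
-- `exists_ev_iid_ratio_le`.
omit [Fintype U] [Fintype Y] in
lemma outC_pi (S : U → X → ℝ) (V : U → X → Y → ℝ) {n : ℕ} (u : Fin n → U) (y : Fin n → Y) :
    outC (piLaw S) (piLaw₂ V) u y = ∏ i, outC S V (u i) (y i) := by
  simp only [outC, ev, piLaw, piLaw₂, ← Finset.prod_mul_distrib]
  exact sum_pi_prod fun i x => S (u i) x * V (u i) x (y i)

omit [Fintype Y] in
lemma out_pi (P : U → ℝ) (S : U → X → ℝ) (V : U → X → Y → ℝ) {n : ℕ} (y : Fin n → Y) :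
    out (iid P) (piLaw S) (piLaw₂ V) y = ∏ i, out P S V (y i) := by
  simp only [out, outC_pi]
  exact ev_iid_prod P fun i u => outC S V u (y i)

omit [Fintype U] in
lemma outC_pos {u : U} {x : X} {y : Y} (hS : ∀ u, S u ∈ stdSimplex ℝ X)
    (hV : ∀ u x, V u x ∈ stdSimplex ℝ Y) (h : 0 < S u x) (h' : 0 < V u x y) :
    0 < outC S V u y :=
  (mul_pos h h').trans_le (Finset.single_le_sum (f := fun x => S u x * V u x y)
    (fun x _ => mul_nonneg ((hS u).1 x) ((hV u x).1 y)) (Finset.mem_univ x))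

lemma out_pos {u : U} {y : Y} (hP : P ∈ stdSimplex ℝ U) (hS : ∀ u, S u ∈ stdSimplex ℝ X)
    (hV : ∀ u x, V u x ∈ stdSimplex ℝ Y) (h : 0 < P u) (h' : 0 < outC S V u y) :
    0 < out P S V y :=
  (mul_pos h h').trans_le (Finset.single_le_sum (f := fun u => P u * outC S V u y)
    (fun u _ => mul_nonneg (hP.1 u) ((outC_mem hS hV u).1 y)) (Finset.mem_univ u))

/-- For thresholds below the information rates the transmitted codeword passes the test with
probability tending to one. -/
theorem exists_missProb_le (hP : P ∈ stdSimplex ℝ U) (hS : ∀ u, S u ∈ stdSimplex ℝ X)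
    (hV : ∀ u x, V u x ∈ stdSimplex ℝ Y) {δ : ℝ} (hδ : 0 < δ) :
    ∃ C : ℝ, ∀ n : ℕ, 0 < n → missProb (iid P : (Fin n → U) → ℝ) (piLaw S) (piLaw₂ V)
      ((2 : ℝ) ^ (n * (infoC P S V - δ))) ((2 : ℝ) ^ (n * (infoT P S V - δ))) ≤ C / n := by
  set q : (U × X) × Y → ℝ := fun ω => P ω.1.1 * S ω.1.1 ω.1.2 * V ω.1.1 ω.1.2 ω.2 with hqdef
  have hq : q ∈ stdSimplex ℝ ((U × X) × Y) :=
    mem_stdSimplex_prod (κ := fun a : U × X => V a.1 a.2) (mem_stdSimplex_prod hP hS)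
      fun a => hV a.1 a.2
  have hev : ∀ F : (U × X) × Y → ℝ, ev q F =
      ev P fun u => ev (S u) fun x => ev (V u x) fun y => F ((u, x), y) := fun F => by
    rw [hqdef, ev_prod (fun a : U × X => P a.1 * S a.1 a.2) fun a : U × X => V a.1 a.2, ev_prod]
  have hevn : ∀ (n : ℕ) (F : (Fin n → U) → (Fin n → X) → (Fin n → Y) → ℝ),
      (ev (iid P) fun u => ev (piLaw S u) fun x => ev (piLaw₂ V u x) fun y => F u x y) =
      ev (iid q) fun ω => F (fun i => (ω i).1.1) (fun i => (ω i).1.2) fun i => (ω i).2 := by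
    intro n F
    rw [ev_iid_piLaw P S fun u x => ev (piLaw₂ V u x) fun y => F u x y]
    exact ev_iid_piLaw (fun a : U × X => P a.1 * S a.1 a.2) (fun a : U × X => V a.1 a.2)
      fun a y => F (fun i => (a i).1) (fun i => (a i).2) y
  have hpos : ∀ a, 0 < q a → 0 < P a.1.1 ∧ 0 < S a.1.1 a.1.2 ∧ 0 < V a.1.1 a.1.2 a.2 := by
    intro a ha
    have h1 := hP.1 a.1.1
    have h2 := (hS a.1.1).1 a.1.2
    have h3 := (hV a.1.1 a.1.2).1 a.2
    refine ⟨h1.lt_of_ne fun h => ?_, h2.lt_of_ne fun h => ?_, h3.lt_of_ne fun h => ?_⟩ <;>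
      simp [hqdef, ← h] at ha
  have hI₁ : infoC P S V = ev q fun a =>
      Real.logb 2 (V a.1.1 a.1.2 a.2 / outC S V a.1.1 a.2) := by rw [hev]; rfl
  have hI₂ : infoT P S V = ev q fun a =>
      Real.logb 2 (V a.1.1 a.1.2 a.2 / out P S V a.2) := by rw [hev]; rfl
  have hC : ∀ a, 0 < q a → 0 < outC S V a.1.1 a.2 := fun a ha =>
    outC_pos (x := a.1.2) hS hV (hpos a ha).2.1 (hpos a ha).2.2
  obtain ⟨C₁, h₁⟩ := exists_ev_iid_ratio_le (f := fun a => V a.1.1 a.1.2 a.2)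
    (g := fun a => outC S V a.1.1 a.2) hq (fun a ha => (hpos a ha).2.2) hC hδ
  obtain ⟨C₂, h₂⟩ := exists_ev_iid_ratio_le (f := fun a => V a.1.1 a.1.2 a.2)
    (g := fun a => out P S V a.2) hq (fun a ha => (hpos a ha).2.2)
    (fun a ha => out_pos hP hS hV (hpos a ha).1 (hC a ha)) hδ
  refine ⟨C₁ + C₂, fun n hn => ?_⟩
  rw [add_div]
  refine le_trans ?_ (add_le_add (h₁ n hn) (h₂ n hn))
  rw [missProb, hevn n fun u x y => ind (¬Test _ _ _ _ _ u x y), ← ev_add, ← hI₁, ← hI₂]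
  refine ev_mono (iid_mem hq).1 fun ω => (ind_mono fun h => ?_).trans (ind_or_le _ _)
  rw [Test, outC_pi, out_pi, not_and_or, not_lt, not_lt] at h
  exact h

end WeakLaw

/-! ### Information inequalities. -/

section LogSum

variable {Z U X Y : Type*} [Fintype Z] [Fintype U] [Fintype X] [Fintype Y]

/-- The log-sum inequality. -/
lemma log_sum_le {r a b : Z → ℝ} (hr : ∀ z, 0 ≤ r z) (ha : ∀ z, 0 ≤ a z) (hb : ∀ z, 0 ≤ b z)
    (hab : ∀ z, 0 < r z → 0 < a z → 0 < b z) :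
    ev r a * Real.logb 2 (ev r a / ev r b) ≤ ev r fun z => a z * Real.logb 2 (a z / b z) := by
  have hA := ev_nonneg hr ha
  rcases hA.eq_or_lt with hA | hA
  · rw [← hA, zero_mul]
    have h0 := (Finset.sum_eq_zero_iff_of_nonneg fun z _ => mul_nonneg (hr z) (ha z)).1 hA.symm
    refine (Finset.sum_eq_zero fun z hz => ?_).ge
    rw [← mul_assoc, h0 z hz, zero_mul]
  have hB : 0 < ev r b := by
    obtain ⟨z, -, hz⟩ := Finset.exists_ne_zero_of_sum_ne_zero hA.ne'
    have hrz := (hr z).lt_of_ne (left_ne_zero_of_mul hz).symm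
    have haz := (ha z).lt_of_ne (right_ne_zero_of_mul hz).symm
    exact (mul_pos hrz (hab z hrz haz)).trans_le (Finset.single_le_sum
      (f := fun z => r z * b z) (fun z _ => mul_nonneg (hr z) (hb z)) (Finset.mem_univ z))
  set A := ev r a with hAd
  set B := ev r b with hBd
  have hl : 0 < Real.log 2 := Real.log_pos one_lt_two
  -- This is log x ≥ 1 - 1/x at x = (a/b)/(A/B); the correction term `a z - b z * (A / B)` has total
  -- `r`-weight zero.
  have key : ∀ z, r z * (a z * Real.logb 2 (A / B) + (a z - b z * (A / B)) / Real.log 2) ≤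
      r z * (a z * Real.logb 2 (a z / b z)) := by
    intro z
    rcases (hr z).eq_or_lt with h | hrz
    · simp [← h]
    refine mul_le_mul_of_nonneg_left ?_ hrz.le
    rcases (ha z).eq_or_lt with h | haz
    · have : 0 ≤ b z * (A / B) / Real.log 2 :=
        div_nonneg (mul_nonneg (hb z) (by positivity)) hl.le
      simp only [← h, zero_mul, zero_add, zero_sub, neg_div]
      linarith
    have hbz := hab z hrz haz
    have h1 := Real.one_sub_inv_le_log_of_pos (x := a z / b z / (A / B)) (by positivity)
    rw [Real.log_div (by positivity) (by positivity)] at h1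
    have h2 : a z * (1 - (a z / b z / (A / B))⁻¹) = a z - b z * (A / B) := by
      field_simp
    have h3 := mul_le_mul_of_nonneg_left h1 haz.le
    rw [h2] at h3
    have h4 := div_le_div_of_nonneg_right h3 hl.le
    simp only [Real.logb]
    have h5 : a z * (Real.log (a z / b z) - Real.log (A / B)) / Real.log 2 =
      a z * (Real.log (a z / b z) / Real.log 2) - a z * (Real.log (A / B) / Real.log 2) := by ring
    linarith
  have hs := Finset.sum_le_sum fun z (_ : z ∈ Finset.univ) => key z
  have h6 : ev r (fun z => a z * Real.logb 2 (A / B) + (a z - b z * (A / B)) / Real.log 2) =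
      A * Real.logb 2 (A / B) := by
    simp only [div_eq_mul_inv _ (Real.log 2)]
    rw [ev_add, ev_mul_const, ev_mul_const, ev_sub, ev_mul_const, ← hAd, ← hBd]
    field_simp
    ring
  exact h6.symm.trans_le hs

/-- Gibbs' inequality. -/
lemma gibbs {v w : Y → ℝ} (hv : v ∈ stdSimplex ℝ Y) (hw : w ∈ stdSimplex ℝ Y)
    (h : ∀ y, 0 < v y → 0 < w y) : 0 ≤ ev v fun y => Real.logb 2 (v y / w y) := by
  have := log_sum_le (r := fun _ => 1) (fun _ => zero_le_one) hv.1 hw.1 fun y _ => h y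
  simpa [ev, hv.2, hw.2] using this

variable {P : U → ℝ} {S : U → X → ℝ} {V : U → X → Y → ℝ}

lemma infoC_nonneg (hP : P ∈ stdSimplex ℝ U) (hS : ∀ u, S u ∈ stdSimplex ℝ X)
    (hV : ∀ u x, V u x ∈ stdSimplex ℝ Y) : 0 ≤ infoC P S V := by
  refine ev_nonneg hP.1 fun u => Finset.sum_nonneg fun x _ => ?_
  rcases ((hS u).1 x).eq_or_lt with h | h
  · rw [← h, zero_mul]
  · exact mul_nonneg h.le (gibbs (hV u x) (outC_mem hS hV u) fun y => outC_pos hS hV h)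

/-- The mutual information between the cloud center and the output. -/
def infoU (P : U → ℝ) (Q : U → Y → ℝ) : ℝ :=
  ev P fun u => ev (Q u) fun y => Real.logb 2 (Q u y / ev P fun u => Q u y)

/-- Chain rule: V/out = (V/outC)(outC/out), where all factors are positive at points of positive
mass. -/
lemma infoT_eq (hP : P ∈ stdSimplex ℝ U) (hS : ∀ u, S u ∈ stdSimplex ℝ X)
    (hV : ∀ u x, V u x ∈ stdSimplex ℝ Y) :
    infoT P S V = infoC P S V + infoU P (outC S V) := by
  have h : infoU P (outC S V) = ev P fun u => ev (S u) fun x => ev (V u x) fun y =>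
      Real.logb 2 (outC S V u y / out P S V y) := by
    simp only [← ev_ev]
    rfl
  rw [h]
  simp only [infoC, infoT, ev, ← Finset.sum_add_distrib, ← mul_add]
  refine Finset.sum_congr rfl fun u _ => ?_
  rcases (hP.1 u).eq_or_lt with hu | hu
  · simp only [← hu, zero_mul]
  congr 1
  refine Finset.sum_congr rfl fun x _ => ?_
  rcases ((hS u).1 x).eq_or_lt with hx | hx
  · simp only [← hx, zero_mul]
  congr 1
  refine Finset.sum_congr rfl fun y _ => ?_
  rcases ((hV u x).1 y).eq_or_lt with hy | hy
  · simp only [← hy, zero_mul]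
  congr 1
  have h1 := outC_pos hS hV hx hy
  have h2 := out_pos hP hS hV hu h1
  rw [← Real.logb_mul (by positivity) (by positivity)]
  congr 1
  field_simp

lemma infoU_nonneg {Q : U → Y → ℝ} (hP : P ∈ stdSimplex ℝ U) (hQ : ∀ u, Q u ∈ stdSimplex ℝ Y) :
    0 ≤ infoU P Q := by
  refine Finset.sum_nonneg fun u _ => ?_
  rcases (hP.1 u).eq_or_lt with h | h
  · rw [← h, zero_mul]
  · refine mul_nonneg h.le (gibbs (hQ u) (ev_mem_stdSimplex hP hQ) fun y hy => ?_)
    exact (mul_pos h hy).trans_le (Finset.single_le_sum (f := fun u => P u * Q u y)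
      (fun u _ => mul_nonneg (hP.1 u) ((hQ u).1 y)) (Finset.mem_univ u))

/-- Refining the side information increases the information about an independent variable. -/
lemma infoC_mixture_le {T : X → ℝ} {R : U → Z → ℝ} {V : Z → X → Y → ℝ}
    (hP : P ∈ stdSimplex ℝ U) (hT : T ∈ stdSimplex ℝ X) (hR : ∀ u, R u ∈ stdSimplex ℝ Z)
    (hV : ∀ z x, V z x ∈ stdSimplex ℝ Y) :
    infoC P (fun _ => T) (fun u x y => ev (R u) fun z => V z x y) ≤
      infoC (fun z => ev P fun u => R u z) (fun _ => T) V := by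
  -- Since `T` does not depend on `u`, numerator and denominator of the likelihood ratio are
  -- mixtures over `z` with the same weights `R u`. The log-sum inequality then applies for each `x`
  -- and `y`.
  have hout : ∀ u y, outC (fun _ => T) (fun u x y => ev (R u) fun z => V z x y) u y =
      ev (R u) fun z => outC (fun _ => T) V z y := fun u y => ev_comm _ _ _
  simp only [infoC]
  rw [ev_ev]
  refine ev_mono hP.1 fun u => ?_
  rw [ev_comm]
  refine Finset.sum_le_sum fun x _ => ?_
  rcases (hT.1 x).eq_or_lt with hx | hx
  · rw [← hx, zero_mul, zero_mul]
  refine mul_le_mul_of_nonneg_left ?_ hx.le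
  beta_reduce
  have : (ev (R u) fun z => ev (V z x) fun y =>
      Real.logb 2 (V z x y / outC (fun _ => T) V z y)) =
      ∑ y, ev (R u) fun z => V z x y * Real.logb 2 (V z x y / outC (fun _ => T) V z y) := by
    rw [← ev_sum]; rfl
  rw [this]
  refine Finset.sum_le_sum fun y _ => ?_
  simp only [hout]
  exact log_sum_le (hR u).1 (fun z => (hV z x).1 y) (fun z => (outC_mem (fun _ => hT) hV z).1 y)
    fun z _ => outC_pos (fun _ => hT) hV hx

end LogSum

/-! ### Mutual informations as nested expectations. -/

section Prob

variable {Ω α β γ : Type*} [Fintype Ω] [Fintype α] [Fintype β] [Fintype γ] {μ : Ω → ℝ}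

omit [Fintype α] in
lemma prob_eq_ev (μ : Ω → ℝ) (X : Ω → α) (a : α) : prob μ X a = ev μ fun ω => ind (X ω = a) := by
  simp [prob, ev, ind]

omit [Fintype α] [Fintype γ] in
/-- Marginalization over the values of `B`. -/
lemma prob_eq_sum {X : Ω → α} {a : α} (B : Ω → β) {T : Ω → γ} {e : β → γ}
    (h : ∀ ω b, T ω = e b ↔ X ω = a ∧ B ω = b) : prob μ X a = ∑ b, prob μ T (e b) := by
  simp only [prob_eq_ev, ← ev_sum, h]
  congr 1; funext ω
  by_cases hX : X ω = a
  · rw [ind_of hX, Finset.sum_eq_single (B ω), ind_of ⟨hX, rfl⟩]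
    · exact fun b _ hb => ind_of_not fun h => hb h.2.symm
    · simp
  · simp [ind, hX]

lemma mutualInfo_eq_infoU {X : Ω → α} {Y : Ω → β} {p : α → ℝ} {w : α → β → ℝ}
    (hw : ∀ x, w x ∈ stdSimplex ℝ β)
    (h : ∀ x y, prob μ (fun ω => (X ω, Y ω)) (x, y) = p x * w x y) :
    mutualInfo μ X Y = infoU p w := by
  have hX : ∀ x, prob μ X x = p x := fun x => by
    rw [prob_eq_sum Y (T := fun ω => (X ω, Y ω)) (e := fun y => (x, y)) (by simp)]
    simp only [h, ← Finset.mul_sum, (hw x).2, mul_one]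
  have hY : ∀ y, prob μ Y y = ev p fun x => w x y := fun y => by
    rw [prob_eq_sum X (T := fun ω => (X ω, Y ω)) (e := fun x => (x, y)) (by simp [and_comm])]
    simp only [h]; rfl
  simp only [mutualInfo, infoU, ev, Finset.mul_sum]
  refine Finset.sum_congr rfl fun x _ => Finset.sum_congr rfl fun y _ => ?_
  rw [h, hX, hY, mul_assoc]
  by_cases hx : p x = 0
  · simp [hx]
  · rw [mul_div_mul_left _ _ hx]; rfl

/-- The factored joint law determines all marginals by normalization, and terms with a vanishing
factor are zero on both sides. -/
lemma condMutualInfo_eq_infoC {X : Ω → α} {Y : Ω → β} {Z : Ω → γ} {P : γ → ℝ} {S : γ → α → ℝ}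
    {V : γ → α → β → ℝ} (hS : ∀ z, S z ∈ stdSimplex ℝ α) (hV : ∀ z x, V z x ∈ stdSimplex ℝ β)
    (h : ∀ x y z, prob μ (fun ω => (X ω, Y ω, Z ω)) (x, y, z) = P z * S z x * V z x y) :
    condMutualInfo μ X Y Z = infoC P S V := by
  have hXZ : ∀ x z, prob μ (fun ω => (X ω, Z ω)) (x, z) = P z * S z x := fun x z => by
    rw [prob_eq_sum Y (T := fun ω => (X ω, Y ω, Z ω)) (e := fun y => (x, y, z))
      (by simp only [Prod.mk.injEq]; tauto)]
    simp only [h, ← Finset.mul_sum, (hV z x).2, mul_one]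
  have hYZ : ∀ y z, prob μ (fun ω => (Y ω, Z ω)) (y, z) = P z * outC S V z y := fun y z => by
    rw [prob_eq_sum X (T := fun ω => (X ω, Y ω, Z ω)) (e := fun x => (x, y, z))
      (by simp only [Prod.mk.injEq]; tauto)]
    simp only [h, outC, ev, Finset.mul_sum, mul_assoc]
  have hZ : ∀ z, prob μ Z z = P z := fun z => by
    rw [prob_eq_sum X (T := fun ω => (X ω, Z ω)) (e := fun x => (x, z))
      (by simp only [Prod.mk.injEq]; tauto)]
    simp only [hXZ, ← Finset.mul_sum, (hS z).2, mul_one]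
  simp only [condMutualInfo, infoC, ev, Finset.mul_sum]
  rw [Finset.sum_congr rfl fun x _ => Finset.sum_comm, Finset.sum_comm]
  refine Finset.sum_congr rfl fun z _ => Finset.sum_congr rfl fun x _ =>
    Finset.sum_congr rfl fun y _ => ?_
  rw [h, hXZ, hYZ, hZ]
  by_cases hz : P z = 0
  · simp [hz]
  by_cases hx : S z x = 0
  · simp [hx]
  have : P z * S z x * V z x y * P z / (P z * S z x * (P z * outC S V z y)) =
      V z x y / outC S V z y := by
    rw [← mul_div_mul_left (V z x y) (outC S V z y) (mul_ne_zero (mul_ne_zero hz hz) hx)]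
    congr 1 <;> ring
  rw [this]
  ring

lemma ev_ind_eq (P : γ → ℝ) (S : γ → α → ℝ) (V : γ → α → β → ℝ) (z : γ) (x : α) (y : β) :
    (ev P fun z' => ev (S z') fun x' => ev (V z' x') fun y' => ind ((x', y', z') = (x, y, z))) =
      P z * S z x * V z x y := by
  classical
  simp [ev, ind, ite_and, mul_assoc]

lemma ev_ind_pair_eq (p : α → ℝ) (w : α → β → ℝ) (x : α) (y : β) :
    (ev p fun x' => ev (w x') fun y' => ind ((x', y') = (x, y))) = p x * w x y := by
  classical
  simp [ev, ind, ite_and]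

/-- The output sees the cloud only through the satellite, so I(U,X;Y) = I(X;Y). -/
lemma infoU_mixture {P : γ → ℝ} {S : γ → α → ℝ} (w : α → β → ℝ) :
    infoU (fun x => ev P fun z => S z x) w = infoT P S fun _ => w := by
  simp only [infoU, infoT, out, outC, ev_ev]

lemma ev_mul (p : α → ℝ) (q : β → ℝ) (f : α × β → ℝ) :
    ev (fun ω : α × β => p ω.1 * q ω.2) f = ev p fun a => ev q fun b => f (a, b) :=
  ev_prod p (fun _ => q) f

lemma infoU_pair {P₁ : α → ℝ} {P₂ : γ → ℝ} (Q : γ → α → β → ℝ) :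
    infoU (fun u : α × γ => P₁ u.1 * P₂ u.2) (fun u => Q u.2 u.1) =
      infoT P₂ (fun _ => P₁) Q := by
  simp only [infoU, infoT, out, outC, ev_mul P₁ P₂]
  rw [ev_comm]
  simp only [ev_comm P₁ P₂]

end Prob

/-! ### The region's bounds and the less noisy condition. -/

section Input

variable {X₁ X₂ Y₁ Y₂ Y₃ U₁ U₂ : Type*} [Fintype X₁] [Fintype X₂] [Fintype Y₁] [Fintype Y₂]
  [Fintype Y₃] [Fintype U₁] [Fintype U₂] (W : Channel X₁ X₂ Y₁ Y₂ Y₃)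

omit [Fintype X₁] [Fintype X₂] in
lemma ev_joint {A : Type*} [Fintype A] (p : A → ℝ) (f₁ : A → X₁) (f₂ : A → X₂)
    (F : A × Y₁ × Y₂ × Y₃ → ℝ) :
    ev (W.joint p f₁ f₂) F = ev p fun a => ev (W.p₁ (f₁ a)) fun y₁ =>
      ev (W.p₂ (f₁ a) (f₂ a)) fun y₂ => ev (W.p₃ (f₂ a)) fun y₃ => F (a, y₁, y₂, y₃) := by
  refine (ev_prod p (fun a => W.trans (f₁ a) (f₂ a)) F).trans ?_
  congr 1; funext a
  exact ev_trans W _ _ fun y => F (a, y)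

lemma ev_input (P₁ : U₁ → ℝ) (S₁ : U₁ → X₁ → ℝ) (P₂ : U₂ → ℝ) (S₂ : U₂ → X₂ → ℝ)
    (F : U₁ × X₁ × U₂ × X₂ → ℝ) :
    ev (fun a : U₁ × X₁ × U₂ × X₂ => P₁ a.1 * S₁ a.1 a.2.1 * P₂ a.2.2.1 * S₂ a.2.2.1 a.2.2.2) F =
      ev P₁ fun u₁ => ev (S₁ u₁) fun x₁ => ev P₂ fun u₂ => ev (S₂ u₂) fun x₂ =>
        F (u₁, x₁, u₂, x₂) := by
  simp only [ev, Fintype.sum_prod_type, Finset.mul_sum, mul_assoc]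

/-- The bounds of the superposition region in terms of the input laws. -/
lemma superpositionBounds_le {k₁ k₂ : ℕ} {P₁ : Fin k₁ → ℝ} {S₁ : Fin k₁ → X₁ → ℝ}
    {P₂ : Fin k₂ → ℝ} {S₂ : Fin k₂ → X₂ → ℝ} (hP₁ : P₁ ∈ stdSimplex ℝ (Fin k₁))
    (hS₁ : ∀ u, S₁ u ∈ stdSimplex ℝ X₁) (hP₂ : P₂ ∈ stdSimplex ℝ (Fin k₂))
    (hS₂ : ∀ u, S₂ u ∈ stdSimplex ℝ X₂) {R : ℝ × ℝ × ℝ}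
    (hR : R ∈ W.superpositionBounds P₁ S₁ P₂ S₂) :
    0 ≤ R.1 ∧ 0 ≤ R.2.1 ∧ 0 ≤ R.2.2 ∧ R.1 ≤ infoC P₁ S₁ (fun _ => W.p₁) ∧
      R.2.1 ≤ infoC P₂ (fun _ => P₁) (cloudChannel S₁ S₂ W.p₂) ∧
      R.2.2 ≤ infoT P₂ S₂ (fun _ => W.p₃) ∧
      R.2.1 + R.2.2 ≤ infoT P₂ (fun _ => P₁) (cloudChannel S₁ S₂ W.p₂) +
        infoC P₂ S₂ (fun _ => W.p₃) := by
  obtain ⟨h1, h2, h3, h4, h5, h6, h7⟩ := hR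
  have hQ := cloudChannel_mem hS₁ hS₂ W.p₂_mem
  refine ⟨h1, h2, h3, h4.trans_eq ?_, h5.trans_eq ?_, h6.trans_eq ?_, h7.trans_eq
    (congrArg₂ _ ?_ ?_)⟩
  · refine condMutualInfo_eq_infoC hS₁ (fun _ => W.p₁_mem) fun x y z => ?_
    rw [prob_eq_ev, ev_joint, ev_input]
    simp only [ev_const (W.p₂_mem _ _), ev_const (W.p₃_mem _), ev_const (hS₂ _), ev_const hP₂]
    exact ev_ind_eq P₁ S₁ (fun _ => W.p₁) z x y
  · refine condMutualInfo_eq_infoC (fun _ => hP₁) hQ fun x y z => ?_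
    rw [prob_eq_ev, ev_joint, ev_input]
    simp only [ev_const (W.p₁_mem _), ev_const (W.p₃_mem _), fun u₁ => ev_comm (S₁ u₁) P₂,
      ← ev_cloudChannel]
    rw [ev_comm]
    exact ev_ind_eq P₂ (fun _ => P₁) (cloudChannel S₁ S₂ W.p₂) z x y
  · refine (mutualInfo_eq_infoU W.p₃_mem fun x y => ?_).trans (infoU_mixture W.p₃)
    rw [prob_eq_ev, ev_joint, ev_input]
    simp only [ev_const (W.p₁_mem _), ev_const (W.p₂_mem _ _), ev_const (hS₁ _), ev_const hP₁]
    exact (ev_ev P₂ S₂ _).symm.trans (ev_ind_pair_eq (fun x => ev P₂ fun u => S₂ u x) W.p₃ x y)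
  · refine (mutualInfo_eq_infoU (p := fun u : Fin k₁ × Fin k₂ => P₁ u.1 * P₂ u.2)
      (w := fun u => cloudChannel S₁ S₂ W.p₂ u.2 u.1) (fun u => hQ u.2 u.1) fun x y => ?_).trans
      (infoU_pair (cloudChannel S₁ S₂ W.p₂))
    rw [prob_eq_ev, ev_joint, ev_input]
    simp only [ev_const (W.p₁_mem _), ev_const (W.p₃_mem _), fun u₁ => ev_comm (S₁ u₁) P₂,
      ← ev_cloudChannel]
    refine Eq.trans ?_ (ev_ind_pair_eq (fun u : Fin k₁ × Fin k₂ => P₁ u.1 * P₂ u.2) (fun u =>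
      cloudChannel S₁ S₂ W.p₂ u.2 u.1) x y)
    rw [ev_mul P₁ P₂]
  · refine condMutualInfo_eq_infoC hS₂ (fun _ => W.p₃_mem) fun x y z => ?_
    rw [prob_eq_ev, ev_joint, ev_input]
    simp only [ev_const (W.p₁_mem _), ev_const (W.p₂_mem _ _), ev_const (hS₁ _), ev_const hP₁]
    exact ev_ind_eq P₂ S₂ (fun _ => W.p₃) z x y

variable {W}

/-- If receiver 1 is interference-cognizant less noisy than receiver 2, then it can decode the
cloud center of sender 1. -/
lemma CognizantLessNoisy.infoC_le (hW : W.CognizantLessNoisy) {k : ℕ} {P₁ : Fin k → ℝ}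
    {S₁ : Fin k → X₁ → ℝ} {P₂ : U₂ → ℝ} {S₂ : U₂ → X₂ → ℝ} (hP₁ : P₁ ∈ stdSimplex ℝ (Fin k))
    (hS₁ : ∀ u, S₁ u ∈ stdSimplex ℝ X₁) (hP₂ : P₂ ∈ stdSimplex ℝ U₂)
    (hS₂ : ∀ u, S₂ u ∈ stdSimplex ℝ X₂) :
    infoC P₂ (fun _ => P₁) (cloudChannel S₁ S₂ W.p₂) ≤
      infoU P₁ (outC S₁ fun _ => W.p₁) := by
  set q : X₂ → ℝ := fun x => ev P₂ fun u => S₂ u x with hqd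
  have hq : q ∈ stdSimplex ℝ X₂ := ev_mem_stdSimplex hP₂ hS₂
  set V : X₂ → Fin k → Y₂ → ℝ := fun x₂ u y => ev (S₁ u) fun x₁ => W.p₂ x₁ x₂ y with hVd
  have hV : ∀ x₂ u, V x₂ u ∈ stdSimplex ℝ Y₂ := fun x₂ u =>
    ev_mem_stdSimplex (hS₁ u) fun x₁ => W.p₂_mem x₁ x₂
  have hcloud : cloudChannel S₁ S₂ W.p₂ = fun u₂ u₁ y => ev (S₂ u₂) fun x₂ => V x₂ u₁ y := by
    funext u₂ u₁ y
    exact ev_comm _ _ _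
  have h := hW k (fun a => P₁ a.1 * S₁ a.1 a.2) q (mem_stdSimplex_prod hP₁ hS₁) hq
  have hin : ∀ F : Fin k × X₁ × X₂ → ℝ,
      ev (fun a : Fin k × X₁ × X₂ => P₁ a.1 * S₁ a.1 a.2.1 * q a.2.2) F =
      ev P₁ fun u₁ => ev (S₁ u₁) fun x₁ => ev q fun x₂ => F (u₁, x₁, x₂) := fun F => by
    simp only [ev, Fintype.sum_prod_type, Finset.mul_sum, mul_assoc]
  -- I(U₁;Y₂|U₂) ≤ I(U₁;Y₂|X₂) ≤ I(U₁;Y₁): the first step refines U₂ to X₂, which is independent of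
  -- U₁, and the second is `hW` with the marginal `q` of X₂.
  refine le_trans ?_ (h.trans_eq ?_)
  · rw [hcloud]
    refine (infoC_mixture_le hP₂ hP₁ hS₂ hV).trans_eq
      (condMutualInfo_eq_infoC (fun _ => hP₁) hV fun x y z => ?_).symm
    rw [prob_eq_ev, ev_joint, hin]
    simp only [ev_const (W.p₁_mem _), ev_const (W.p₃_mem _)]
    simp only [fun u₁ => ev_comm (S₁ u₁) q]
    rw [ev_comm]
    simp only [← ev_ev]
    exact ev_ind_eq q (fun _ => P₁) V z x y
  · refine mutualInfo_eq_infoU (outC_mem hS₁ fun _ => W.p₁_mem) fun x y => ?_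
    rw [prob_eq_ev, ev_joint, hin]
    simp only [ev_const (W.p₂_mem _ _), ev_const (W.p₃_mem _), ev_const hq]
    simp only [← ev_ev]
    exact ev_ind_pair_eq P₁ (outC S₁ fun _ => W.p₁) x y

end Input

/-! ### Message set sizes against thresholds. -/

section Size

/-- The number of messages for the rate `r` with slack `s` at block length `n`. -/
def size (r s : ℝ) (n : ℕ) : ℕ := ⌈(2 : ℝ) ^ (n * (r - s))⌉₊

variable {r s : ℝ} {n : ℕ}

lemma size_pos (r s : ℝ) (n : ℕ) : 0 < size r s n := Nat.ceil_pos.2 (by positivity)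

lemma size_sub_one_nonneg (r s : ℝ) (n : ℕ) : (0 : ℝ) ≤ size r s n - 1 := by
  have : (1 : ℝ) ≤ size r s n := by exact_mod_cast size_pos r s n
  linarith

/-- Counting only wrong messages absorbs the rounding. This matters at rate zero and information
zero, where the threshold itself decays like 2^(-nδ). -/
lemma size_sub_one_le (r s : ℝ) (n : ℕ) : (size r s n : ℝ) - 1 ≤ 2 ^ (n * (r - s)) := by
  have := Nat.ceil_lt_add_one (a := (2 : ℝ) ^ (n * (r - s))) (by positivity)
  unfold size
  linarith

lemma size_le (hr : 0 ≤ r) (hs : 0 ≤ s) (n : ℕ) : (size r s n : ℝ) ≤ 2 * 2 ^ (n * r) := by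
  have h1 := size_sub_one_le r s n
  have h2 : (2 : ℝ) ^ (n * (r - s)) ≤ 2 ^ (n * r) :=
    Real.rpow_le_rpow_of_exponent_le one_le_two
      (mul_le_mul_of_nonneg_left (by linarith) n.cast_nonneg)
  have h3 : (1 : ℝ) ≤ 2 ^ (n * r) := Real.one_le_rpow one_le_two (by positivity)
  linarith

lemma sub_le_logb_size (hn : 0 < n) : r - s ≤ Real.logb 2 (size r s n) / n := by
  have hn' : (0 : ℝ) < n := by exact_mod_cast hn
  rw [le_div_iff₀ hn', Real.le_logb_iff_rpow_le one_lt_two (by exact_mod_cast size_pos r s n),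
    mul_comm]
  exact Nat.le_ceil _

lemma logb_size_le (hr : 0 ≤ r) (hs : 0 ≤ s) (hn : 0 < n) :
    Real.logb 2 (size r s n) / n ≤ r + 1 / n := by
  have hn' : (0 : ℝ) < n := by exact_mod_cast hn
  rw [div_le_iff₀ hn', Real.logb_le_iff_le_rpow one_lt_two (by exact_mod_cast size_pos r s n)]
  refine (size_le hr hs n).trans_eq ?_
  rw [show (r + 1 / n) * n = 1 + n * r by field_simp; ring, Real.rpow_add two_pos, Real.rpow_one]

lemma size_sub_one_div_le {δ I : ℝ} (h : r ≤ I) :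
    ((size r (2 * δ) n : ℝ) - 1) / 2 ^ (n * (I - δ)) ≤ 2 ^ (-(n * δ)) := by
  rw [div_le_iff₀ (by positivity), ← Real.rpow_add two_pos]
  refine (size_sub_one_le _ _ _).trans (Real.rpow_le_rpow_of_exponent_le one_le_two ?_)
  have : (0 : ℝ) ≤ n * (I - r) := mul_nonneg n.cast_nonneg (by linarith)
  nlinarith

/-- Only the first factor keeps its slack 2δ: one δ pays for the threshold and the other remains as
decay. The second factor is bounded by `size_le`, whence the 2. -/
lemma size_sub_one_mul_size_div_le {δ I r' : ℝ} (hδ : 0 ≤ δ) (hr : 0 ≤ r') (h : r + r' ≤ I) :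
    ((size r (2 * δ) n : ℝ) - 1) * size r' (2 * δ) n / 2 ^ (n * (I - δ)) ≤
      2 * 2 ^ (-(n * δ)) := by
  rw [div_le_iff₀ (by positivity), mul_assoc, ← Real.rpow_add two_pos]
  have h1 := mul_le_mul (size_sub_one_le r (2 * δ) n) (size_le hr (by linarith : 0 ≤ 2 * δ) n)
    (by positivity) (by positivity)
  refine h1.trans ?_
  rw [mul_left_comm, ← Real.rpow_add two_pos]
  refine mul_le_mul_of_nonneg_left (Real.rpow_le_rpow_of_exponent_le one_le_two ?_) two_pos.le
  have : (0 : ℝ) ≤ n * (I - r - r') := mul_nonneg n.cast_nonneg (by linarith)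
  nlinarith

end Size

/-! ### From tolerances to code sequences and closures. -/

variable {X₁ X₂ Y₁ Y₂ Y₃ : Type*} [Fintype X₁] [Fintype X₂] [Fintype Y₁] [Fintype Y₂] [Fintype Y₃]

/-- For every tolerance and every large block length there is a code whose rates are within the
tolerance of `R` and whose error probability is below it. -/
def Approximable (W : Channel X₁ X₂ Y₁ Y₂ Y₃) (R : ℝ × ℝ × ℝ) : Prop :=
  ∀ ε > 0, ∀ᶠ n : ℕ in Filter.atTop, ∃ (M₁ M₂ M₃ : ℕ) (c : Code X₁ X₂ Y₁ Y₂ Y₃ M₁ M₂ M₃ n),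
    (1 ≤ M₁ ∧ 1 ≤ M₂ ∧ 1 ≤ M₃) ∧ |Real.logb 2 M₁ / n - R.1| < ε ∧
      |Real.logb 2 M₂ / n - R.2.1| < ε ∧ |Real.logb 2 M₃ / n - R.2.2| < ε ∧ W.errorProb c < ε

omit [Fintype X₁] [Fintype X₂] in
lemma errorProb_nonneg (W : Channel X₁ X₂ Y₁ Y₂ Y₃) {M₁ M₂ M₃ n : ℕ}
    (c : Code X₁ X₂ Y₁ Y₂ Y₃ M₁ M₂ M₃ n) : 0 ≤ W.errorProb c := by
  refine div_nonneg ?_ (by positivity)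
  iterate 6 refine Finset.sum_nonneg fun _ _ => ?_
  split_ifs
  · exact Finset.prod_nonneg fun i _ => (trans_mem W _ _).1 _
  · exact le_rfl

omit [Fintype X₁] [Fintype X₂] in
/-- Codes for a sequence of shrinking tolerances can be arranged into a single sequence. -/
lemma Approximable.achievable [Nonempty X₁] [Nonempty X₂] {W : Channel X₁ X₂ Y₁ Y₂ Y₃}
    {R : ℝ × ℝ × ℝ} (h : Approximable W R) : W.Achievable R := by
  let good (n : ℕ) (d : ℝ) : Prop := ∃ (M₁ M₂ M₃ : ℕ) (c : Code X₁ X₂ Y₁ Y₂ Y₃ M₁ M₂ M₃ n),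
    (1 ≤ M₁ ∧ 1 ≤ M₂ ∧ 1 ≤ M₃) ∧ |Real.logb 2 M₁ / n - R.1| ≤ d ∧
      |Real.logb 2 M₂ / n - R.2.1| ≤ d ∧ |Real.logb 2 M₃ / n - R.2.2| ≤ d ∧ W.errorProb c ≤ d
  -- The trivial one-message code meets some finite tolerance at every block length, including 0.
  have hne : ∀ n, ∃ d, good n d := fun n => by
    let c : Code X₁ X₂ Y₁ Y₂ Y₃ 1 1 1 n := ⟨fun _ _ _ => Classical.arbitrary _,
      fun _ _ => Classical.arbitrary _, fun _ => 0, fun _ => 0, fun _ => 0⟩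
    refine ⟨|Real.logb 2 (1 : ℕ) / n - R.1| + |Real.logb 2 (1 : ℕ) / n - R.2.1| +
      |Real.logb 2 (1 : ℕ) / n - R.2.2| + W.errorProb c, 1, 1, 1, c, by simp, ?_⟩
    have h1 := abs_nonneg (Real.logb 2 (1 : ℕ) / n - R.1)
    have h2 := abs_nonneg (Real.logb 2 (1 : ℕ) / n - R.2.1)
    have h3 := abs_nonneg (Real.logb 2 (1 : ℕ) / n - R.2.2)
    have h4 := errorProb_nonneg W c
    refine ⟨?_, ?_, ?_, ?_⟩ <;> linarith
  have hbdd : ∀ n, BddBelow {d | good n d} := fun n =>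
    ⟨0, fun d ⟨_, _, _, _, _, hd, _⟩ => (abs_nonneg _).trans hd⟩
  -- The infimum of the tolerances need not be attained; a code within 1/(n+1) of it is enough.
  have hex : ∀ n : ℕ, ∃ d, good n d ∧ d < sInf {d | good n d} + 1 / (n + 1) := fun n =>
    exists_lt_of_csInf_lt (hne n) (lt_add_of_pos_right _ Nat.one_div_pos_of_nat)
  choose d hd hlt using hex
  have hlim : Filter.Tendsto d Filter.atTop (nhds 0) := by
    rw [Metric.tendsto_atTop]
    intro ε hε
    obtain ⟨N, hN⟩ := Filter.eventually_atTop.1 ((h (ε / 2) (half_pos hε)).and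
      ((tendsto_one_div_add_atTop_nhds_zero_nat (𝕜 := ℝ)).eventually_lt_const (half_pos hε)))
    refine ⟨N, fun n hn => ?_⟩
    obtain ⟨⟨M₁, M₂, M₃, c, hM, h1, h2, h3, h4⟩, h5⟩ := hN n hn
    have h6 : sInf {d | good n d} ≤ ε / 2 :=
      csInf_le (hbdd n) ⟨M₁, M₂, M₃, c, hM, h1.le, h2.le, h3.le, h4.le⟩
    have h7 : 0 ≤ d n := by
      obtain ⟨_, _, _, _, _, hd, _⟩ := hd n
      exact (abs_nonneg _).trans hd
    rw [Real.dist_eq, sub_zero, abs_of_nonneg h7]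
    linarith [hlt n]
  choose M₁ M₂ M₃ c hM h1 h2 h3 h4 using hd
  refine ⟨M₁, M₂, M₃, c, hM, ?_, ?_, ?_, squeeze_zero (fun n => errorProb_nonneg W _) h4 hlim⟩
  · exact tendsto_iff_dist_tendsto_zero.2 (squeeze_zero (fun _ => dist_nonneg) h1 hlim)
  · exact tendsto_iff_dist_tendsto_zero.2 (squeeze_zero (fun _ => dist_nonneg) h2 hlim)
  · exact tendsto_iff_dist_tendsto_zero.2 (squeeze_zero (fun _ => dist_nonneg) h3 hlim)

omit [Fintype X₁] [Fintype X₂] in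
lemma approximable_of_mem_closure {W : Channel X₁ X₂ Y₁ Y₂ Y₃} {A : Set (ℝ × ℝ × ℝ)}
    (hA : ∀ R ∈ A, Approximable W R) {R : ℝ × ℝ × ℝ} (hR : R ∈ closure A) : Approximable W R := by
  intro ε hε
  obtain ⟨R', hR', hd⟩ := Metric.mem_closure_iff.1 hR (ε / 2) (half_pos hε)
  rw [dist_comm, Prod.dist_eq, Prod.dist_eq, max_lt_iff, max_lt_iff, Real.dist_eq, Real.dist_eq,
    Real.dist_eq] at hd
  filter_upwards [hA R' hR' (ε / 2) (half_pos hε)] with n hn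
  obtain ⟨M₁, M₂, M₃, c, hM, h1, h2, h3, h4⟩ := hn
  refine ⟨M₁, M₂, M₃, c, hM, ?_, ?_, ?_, by linarith⟩
  · linarith [abs_sub_le (Real.logb 2 M₁ / n) R'.1 R.1]
  · linarith [abs_sub_le (Real.logb 2 M₂ / n) R'.2.1 R.2.1]
  · linarith [abs_sub_le (Real.logb 2 M₃ / n) R'.2.2 R.2.2]

/-! ### Coding theorem for a fixed input distribution. -/

lemma ev_piLaw_prod {α β : Type*} [Fintype β] (κ : α → β → ℝ) {n : ℕ} (a : Fin n → α)
    (f : Fin n → β → ℝ) :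
    ev (piLaw κ a) (fun b => ∏ i, f i (b i)) = ∏ i, ev (κ (a i)) (f i) := by
  simp only [ev, piLaw, ← Finset.prod_mul_distrib]
  exact sum_pi_prod fun i b => κ (a i) b * f i b

/-- Averaging over product satellites acts letter by letter, so the channel between cloud centers
and output is again memoryless. -/
lemma cloudChannel_pow {U₁ U₂ : Type*} (W : Channel X₁ X₂ Y₁ Y₂ Y₃) (S₁ : U₁ → X₁ → ℝ)
    (S₂ : U₂ → X₂ → ℝ) (n : ℕ) :
    cloudChannel (piLaw S₁) (piLaw S₂) (W.pow n).p₂ =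
      (piLaw₂ (cloudChannel S₁ S₂ W.p₂) : (Fin n → U₂) → (Fin n → U₁) → (Fin n → Y₂) → ℝ) := by
  funext u₂ u₁ y
  have h : ∀ x₁ : Fin n → X₁, (ev (piLaw S₂ u₂) fun x₂ => (W.pow n).p₂ x₁ x₂ y) =
      ∏ i, ev (S₂ (u₂ i)) fun x₂ => W.p₂ (x₁ i) x₂ (y i) := fun x₁ =>
    ev_piLaw_prod S₂ u₂ fun i x₂ => W.p₂ (x₁ i) x₂ (y i)
  simp only [cloudChannel, h]
  exact ev_piLaw_prod S₁ u₁ fun i x₁ => ev (S₂ (u₂ i)) fun x₂ => W.p₂ x₁ x₂ (y i)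

lemma nonempty_of_mem_stdSimplex {α : Type*} [Fintype α] {p : α → ℝ} (hp : p ∈ stdSimplex ℝ α) :
    Nonempty α := by
  by_contra hα
  rw [not_nonempty_iff] at hα
  simpa using hp.2

/-- Superposition coding with the message of sender 2 split into two parts. -/
theorem approximable_of_split {U₁ U₂ : Type*} [Fintype U₁] [Fintype U₂]
    (W : Channel X₁ X₂ Y₁ Y₂ Y₃) {P₁ : U₁ → ℝ} {S₁ : U₁ → X₁ → ℝ} {P₂ : U₂ → ℝ} {S₂ : U₂ → X₂ → ℝ}
    (hP₁ : P₁ ∈ stdSimplex ℝ U₁) (hS₁ : ∀ u, S₁ u ∈ stdSimplex ℝ X₁)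
    (hP₂ : P₂ ∈ stdSimplex ℝ U₂) (hS₂ : ∀ u, S₂ u ∈ stdSimplex ℝ X₂) {r₁ r₂ s t : ℝ}
    (hr₁ : 0 ≤ r₁) (hr₂ : 0 ≤ r₂) (hs : 0 ≤ s) (ht : 0 ≤ t)
    (h₁ : r₁ ≤ infoC P₁ S₁ fun _ => W.p₁) (h₁₂ : r₂ + r₁ ≤ infoT P₁ S₁ fun _ => W.p₁)
    (h₂ : r₂ ≤ infoC P₂ (fun _ => P₁) (cloudChannel S₁ S₂ W.p₂))
    (h₂₃ : s + r₂ ≤ infoT P₂ (fun _ => P₁) (cloudChannel S₁ S₂ W.p₂))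
    (h₃ : t ≤ infoC P₂ S₂ fun _ => W.p₃) (h₃₃ : s + t ≤ infoT P₂ S₂ fun _ => W.p₃) :
    Approximable W (r₁, r₂, s + t) := by
  intro ε hε
  -- Each message part loses at most 2δ of rate, so the split message loses at most 4δ = ε/2.
  set δ := ε / 8 with hδd
  have hδ : 0 < δ := by positivity
  obtain ⟨C₁, hC₁⟩ := exists_missProb_le hP₁ hS₁ (fun _ => W.p₁_mem) hδ
  obtain ⟨C₂, hC₂⟩ := exists_missProb_le hP₂ (fun _ => hP₁)
    (cloudChannel_mem hS₁ hS₂ W.p₂_mem) hδ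
  obtain ⟨C₃, hC₃⟩ := exists_missProb_le hP₂ hS₂ (fun _ => W.p₃_mem) hδ
  -- Each of the three receivers contributes 1 + 2 multiples of 2^(-nδ), hence the 9.
  have hlim : Filter.Tendsto (fun n : ℕ => (C₁ + C₂ + C₃) / n + 9 * (2 : ℝ) ^ (-(n * δ)))
      Filter.atTop (nhds 0) := by
    have h1 := tendsto_const_div_atTop_nhds_zero_nat (C₁ + C₂ + C₃)
    have h2 : Filter.Tendsto (fun n : ℕ => (2 : ℝ) ^ (-(n * δ))) Filter.atTop (nhds 0) := by
      have h3 := tendsto_pow_atTop_nhds_zero_of_lt_one (r := (2 : ℝ) ^ (-δ)) (by positivity)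
        (Real.rpow_lt_one_of_one_lt_of_neg one_lt_two (by linarith))
      refine h3.congr fun n => ?_
      rw [← Real.rpow_mul_natCast two_pos.le]
      congr 1
      ring
    simpa using h1.add (h2.const_mul 9)
  filter_upwards [hlim.eventually_lt_const hε, Filter.eventually_gt_atTop 0,
    (tendsto_one_div_atTop_nhds_zero_nat (𝕜 := ℝ)).eventually_lt_const hδ] with n herr hn hinv
  obtain ⟨c, hc⟩ := exists_code W (n := n) (P₁ := iid P₁) (S₁ := piLaw S₁) (P₂ := iid P₂)
    (S₂ := piLaw S₂) (iid_mem hP₁) (piLaw_mem hS₁) (iid_mem hP₂) (piLaw_mem hS₂)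
    (a₁ := 2 ^ (n * ((infoC P₁ S₁ fun _ => W.p₁) - δ)))
    (a₂ := 2 ^ (n * ((infoT P₁ S₁ fun _ => W.p₁) - δ)))
    (b₁ := 2 ^ (n * (infoC P₂ (fun _ => P₁) (cloudChannel S₁ S₂ W.p₂) - δ)))
    (b₂ := 2 ^ (n * (infoT P₂ (fun _ => P₁) (cloudChannel S₁ S₂ W.p₂) - δ)))
    (c₁ := 2 ^ (n * ((infoC P₂ S₂ fun _ => W.p₃) - δ)))
    (c₂ := 2 ^ (n * ((infoT P₂ S₂ fun _ => W.p₃) - δ)))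
    (by positivity) (by positivity) (by positivity) (by positivity) (by positivity) (by positivity)
    (size_pos r₁ (2 * δ) n) (size_pos r₂ (2 * δ) n) (size_pos s (2 * δ) n) (size_pos t (2 * δ) n)
  rw [cloudChannel_pow] at hc
  have hpos := fun r => size_pos r (2 * δ) n
  have h2δ : 0 ≤ 2 * δ := by positivity
  have hrate : ∀ r, 0 ≤ r → r - 2 * δ ≤ Real.logb 2 (size r (2 * δ) n) / n ∧
      Real.logb 2 (size r (2 * δ) n) / n ≤ r + δ := fun r hr =>
    ⟨sub_le_logb_size hn, (logb_size_le hr h2δ hn).trans (by linarith)⟩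
  refine ⟨_, _, _, c, ⟨hpos r₁, hpos r₂, Nat.mul_pos (hpos s) (hpos t)⟩, ?_, ?_, ?_,
    hc.trans_lt ?_⟩
  · obtain ⟨h, h'⟩ := hrate r₁ hr₁
    rw [abs_lt]; constructor <;> linarith
  · obtain ⟨h, h'⟩ := hrate r₂ hr₂
    rw [abs_lt]; constructor <;> linarith
  · obtain ⟨h, h'⟩ := hrate s hs
    obtain ⟨g, g'⟩ := hrate t ht
    have e : Real.logb 2 ((size s (2 * δ) n * size t (2 * δ) n : ℕ) : ℝ) / n =
        Real.logb 2 (size s (2 * δ) n) / n + Real.logb 2 (size t (2 * δ) n) / n := by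
      rw [Nat.cast_mul, Real.logb_mul (by exact_mod_cast (hpos s).ne')
        (by exact_mod_cast (hpos t).ne'), add_div]
    rw [e, abs_lt]; constructor <;> linarith
  · refine lt_of_le_of_lt ?_ herr
    have e₁ : missProb (iid P₁) (piLaw S₁) (fun _ => (W.pow n).p₁) _ _ ≤ _ := hC₁ n hn
    have e₂ : missProb (iid P₂) (fun _ => iid P₁) (piLaw₂ (cloudChannel S₁ S₂ W.p₂)) _ _ ≤ _ :=
      hC₂ n hn
    have e₃ : missProb (iid P₂) (piLaw S₂) (fun _ => (W.pow n).p₃) _ _ ≤ _ := hC₃ n hn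
    have f₁ := size_sub_one_div_le (n := n) (δ := δ) h₁
    have f₂ := size_sub_one_mul_size_div_le (n := n) hδ.le hr₁ h₁₂
    have f₃ := size_sub_one_div_le (n := n) (δ := δ) h₂
    have f₄ := size_sub_one_mul_size_div_le (n := n) hδ.le hr₂ h₂₃
    have f₅ := size_sub_one_div_le (n := n) (δ := δ) h₃
    have f₆ := size_sub_one_mul_size_div_le (n := n) hδ.le ht h₃₃
    have f₇ : ((size s (2 * δ) n : ℝ) - 1) * (size r₂ (2 * δ) n - 1) /
        2 ^ (n * (infoT P₂ (fun _ => P₁) (cloudChannel S₁ S₂ W.p₂) - δ)) ≤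
        ((size s (2 * δ) n : ℝ) - 1) * size r₂ (2 * δ) n /
        2 ^ (n * (infoT P₂ (fun _ => P₁) (cloudChannel S₁ S₂ W.p₂) - δ)) := by
      gcongr
      · exact size_sub_one_nonneg _ _ _
      · linarith
    rw [add_div, add_div]
    linarith

end BIC

end

/-! ### Rate splitting. -/

theorem mainTheorem8 {X₁ X₂ Y₁ Y₂ Y₃ : Type*}
    [Fintype X₁] [Fintype X₂] [Fintype Y₁] [Fintype Y₂] [Fintype Y₃]
    (W : BIC.Channel X₁ X₂ Y₁ Y₂ Y₃) (hW : W.CognizantLessNoisy) :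
    ∀ R ∈ W.superpositionRegion, W.Achievable R := by
  intro R hR
  -- The closure of the empty set is empty, so some input distribution exists and both input
  -- alphabets are nonempty.
  have hne : Nonempty X₁ ∧ Nonempty X₂ := by
    obtain ⟨R', k₁, k₂, P₁, S₁, P₂, S₂, hP₁, hS₁, hP₂, hS₂, -⟩ := closure_nonempty_iff.1 ⟨R, hR⟩
    obtain ⟨u₁⟩ := BIC.nonempty_of_mem_stdSimplex hP₁
    obtain ⟨u₂⟩ := BIC.nonempty_of_mem_stdSimplex hP₂
    exact ⟨BIC.nonempty_of_mem_stdSimplex (hS₁ u₁), BIC.nonempty_of_mem_stdSimplex (hS₂ u₂)⟩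
  obtain ⟨_, _⟩ := hne
  refine (BIC.approximable_of_mem_closure ?_ hR).achievable
  rintro ⟨R₁, R₂, R₃⟩ ⟨k₁, k₂, P₁, S₁, P₂, S₂, hP₁, hS₁, hP₂, hS₂, hb⟩
  obtain ⟨h₁, h₂, h₃, h₄, h₅, h₆, h₇⟩ := BIC.superpositionBounds_le W hP₁ hS₁ hP₂ hS₂ hb
  dsimp only at h₁ h₂ h₃ h₄ h₅ h₆ h₇
  have hQ := BIC.cloudChannel_mem hS₁ hS₂ W.p₂_mem
  have hU := BIC.CognizantLessNoisy.infoC_le hW hP₁ hS₁ hP₂ hS₂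
  have hT₁ := BIC.infoT_eq hP₁ hS₁ fun _ => W.p₁_mem
  have hT₂ := BIC.infoT_eq hP₂ (fun _ => hP₁) hQ
  have hU₂ := BIC.infoU_nonneg hP₂ (BIC.outC_mem (fun _ => hP₁) hQ)
  have hJ := BIC.infoC_nonneg hP₂ hS₂ fun _ => W.p₃_mem
  set J := BIC.infoC P₂ S₂ fun _ => W.p₃
  -- As much of R₃ as receiver 3 can resolve goes into the satellite, which receiver 2 treats as
  -- noise; only the excess burdens the cloud.
  have hsplit : R₃ = (R₃ - min R₃ J) + min R₃ J := by ring
  rw [hsplit]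
  have hmin := min_le_left R₃ J
  refine BIC.approximable_of_split W hP₁ hS₁ hP₂ hS₂ h₁ h₂ (by linarith) (le_min h₃ hJ) h₄
    (by linarith) h₅ ?_ (min_le_right _ _) (by linarith)
  -- If the minimum is R₃, the cloud rate is zero and R₂ ≤ I(U₁;Y₂|U₂) ≤ I(U₁,U₂;Y₂). If it is `J`,
  -- the claim is the region's bound on R₂ + R₃.
  rcases min_choice R₃ J with h | h <;> rw [h] <;> linarith
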